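/- Let $n, L \ge 1$ be integers, let $\Sigma$ be a real symmetric positive semidefinite $n\times n$ matrix (possibly singular), and let $\tilde x_1,\ldots,\tilde x_L$ be i.i.d. random vectors in $\mathbb R^n$ with distribution $\mathcal N(0,\Sigma)$. Let $$\widehat\Sigma=\frac1L\sum_{i=1}^L \tilde x_i\tilde x_i^{\top}$$ be their sample covariance matrix, and let $\|\cdot\|$ denote the spectral norm (the operator norm with respect to the Euclidean norm). Let $\delta_0>0$ be a constant. If $$L\ \ge\ 4\,n^{1/2}\,\mathrm{tr}(\Sigma)\left(\frac{\|\Sigma\|}{\delta_0^2}+\frac{4}{\delta_0}\right),$$ then $$\mathbb P\bigl\{\|\widehat\Sigma-\Sigma\|\le\delta_0\bigr\}\ >\ 1-2n\exp(-\sqrt n).$$ -/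

import Mathlib

open MeasureTheory ProbabilityTheory
open scoped Matrix.Norms.L2Operator

/-- The (zero-mean) sample covariance matrix `(1 / L) * ∑ i, xᵢ xᵢᵀ` of `L` vectors in `ℝⁿ`. -/
noncomputable def sampleCovariance {n L : ℕ} (x : Fin L → EuclideanSpace ℝ (Fin n)) :
    Matrix (Fin n) (Fin n) ℝ :=
  (1 / (L : ℝ)) • ∑ i : Fin L, Matrix.vecMulVec (x i).ofLp (x i).ofLp

/-!
The proof is the matrix Laplace transform method in the form of Ahlswede and Winter. Write
`X = x xᵀ - S` for a single centred summand, `T = tr S` and `s = ‖S‖`. If the spectral norm of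
`∑ Xᵢ` exceeds `L δ`, then `tr exp (± θ ∑ Xᵢ) ≥ exp (θ L δ)` for one of the signs
(`Matrix.exp_lt_trace_exp_of_lt_norm`). The Golden–Thompson inequality
`tr exp (A + B) ≤ tr (exp A exp B)` (`Matrix.trace_exp_add_le`) splits off one summand at a time; as
the summands are identically distributed, the mean of the trace is at most `n C ^ L`, where
`C` bounds `𝔼 exp (± θ X)` from above (`Matrix.lintegral_pi_trace_exp_le`). Golden–Thompson is
obtained from the Lie product formula and trace inequalities for powers `2 ^ k`.

It remains to show that `C = 1 + θ² T s / (1 - 8 θ T)` works when `θ T < 1 / 8`. If `Y ≤ r` with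
`r ≥ 0` then `exp Y ≤ 1 + Y + (1 / 2 + (r / 6) exp r) Y²`. The linear term has mean zero, and by
Isserlis' formula `𝔼 ‖X u‖² = T (u ⬝ S u) + ‖S u‖² ≤ 2 T s ‖u‖²`, which accounts for `θ² T s`; this
has to be exact, as it is sharp for `S` of rank one. The rest carries a further factor `θ`, so
cruder bounds suffice. For `-X` one takes `r = θ s`. For `X` one takes `r = θ ‖x‖²`, and Jensen's
inequality for `‖x‖² = ∑ Sⱼⱼ bⱼ²` with standard Gaussian `bⱼ`, followed by Young's inequality,
leaves only tilted moments of a single standard Gaussian.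

Finally `θ = δ / (2 T (s + 4 δ))` makes `C = 1 + θ δ / 2`, and the assumption on `L` says precisely
that `L θ δ / 2 ≥ √n`. The inequality is strict because `1 + y < exp y` for `y > 0`. When `T = 0` the
sample is almost surely zero.
-/

/-! ### The Golden–Thompson inequality -/

section LieTrotter

open Filter Topology NormedSpace

variable {𝔸 : Type*} [NormedRing 𝔸]

lemma norm_pow_sub_pow_le [NormOneClass 𝔸] {x y : 𝔸} {R : ℝ} (hR : 1 ≤ R) (hx : ‖x‖ ≤ R)
    (hy : ‖y‖ ≤ R) (m : ℕ) : ‖x ^ m - y ^ m‖ ≤ m * ‖x - y‖ * R ^ m := by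
  induction m with
  | zero => simp
  | succ m ih =>
    have h : x ^ (m + 1) - y ^ (m + 1) = x * (x ^ m - y ^ m) + (x - y) * y ^ m := by
      rw [pow_succ', pow_succ']; noncomm_ring
    have hym : ‖y ^ m‖ ≤ R ^ m :=
      (norm_pow_le y m).trans (pow_le_pow_left₀ (norm_nonneg _) hy m)
    have hRm : R ^ m ≤ R ^ (m + 1) := pow_le_pow_right₀ hR m.le_succ
    calc ‖x ^ (m + 1) - y ^ (m + 1)‖
        ≤ ‖x‖ * ‖x ^ m - y ^ m‖ + ‖x - y‖ * ‖y ^ m‖ := by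
          rw [h]; exact (norm_add_le _ _).trans (add_le_add (norm_mul_le _ _) (norm_mul_le _ _))
      _ ≤ R * (m * ‖x - y‖ * R ^ m) + ‖x - y‖ * R ^ (m + 1) := by
          gcongr
          exact hym.trans hRm
      _ = ((m + 1 : ℕ) : ℝ) * ‖x - y‖ * R ^ (m + 1) := by push_cast; ring

/-- The **Lie product formula** in a real Banach algebra. The two curves `t ↦ exp (t A) exp (t B)`
and `t ↦ exp (t (A + B))` agree to first order at `0`, and `m`-th powers of `1 + O(1 / m)` stay
bounded. -/
lemma tendsto_exp_mul_exp_pow [NormOneClass 𝔸] [NormedAlgebra ℝ 𝔸] [CompleteSpace 𝔸] (A B : 𝔸) :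
    Tendsto (fun m : ℕ ↦ (exp ((m : ℝ)⁻¹ • A) * exp ((m : ℝ)⁻¹ • B)) ^ m) atTop
      (𝓝 (exp (A + B))) := by
  set c : ℝ → 𝔸 := fun t ↦ exp (t • A) * exp (t • B) with hc
  set d : ℝ → 𝔸 := fun t ↦ exp (t • (A + B)) with hd
  have hc0 : c 0 = 1 := by simp [hc]
  have hd0 : d 0 = 1 := by simp [hd]
  have hcd : HasDerivAt c (A + B) 0 := by
    have h := (hasDerivAt_exp_smul_const (𝕂 := ℝ) A 0).mul (hasDerivAt_exp_smul_const (𝕂 := ℝ) B 0)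
    simp only [zero_smul, exp_zero, one_mul, mul_one] at h
    exact h
  have hdd : HasDerivAt d (A + B) 0 := by
    have h := hasDerivAt_exp_smul_const (𝕂 := ℝ) (A + B) 0
    simpa only [zero_smul, exp_zero, one_mul] using h
  have hinv : Tendsto (fun m : ℕ ↦ (m : ℝ)⁻¹) atTop (𝓝 0) := tendsto_inv_atTop_nhds_zero_nat
  -- both curves are `1 + O(t)`
  obtain ⟨K, hK0, hK⟩ : ∃ K : ℝ, 0 ≤ K ∧ ∀ᶠ t in 𝓝 (0 : ℝ),
      ‖c t‖ ≤ 1 + K * |t| ∧ ‖d t‖ ≤ 1 + K * |t| := by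
    obtain ⟨K₁, hK₁, h₁⟩ := hcd.isBigO_sub.exists_pos
    obtain ⟨K₂, hK₂, h₂⟩ := hdd.isBigO_sub.exists_pos
    refine ⟨K₁ + K₂, by positivity, ?_⟩
    filter_upwards [h₁.bound, h₂.bound] with t ht₁ ht₂
    rw [hc0, sub_zero, Real.norm_eq_abs] at ht₁
    rw [hd0, sub_zero, Real.norm_eq_abs] at ht₂
    have e₁ : ‖c t‖ ≤ ‖c t - 1‖ + 1 := by simpa using norm_add_le (c t - 1) 1
    have e₂ : ‖d t‖ ≤ ‖d t - 1‖ + 1 := by simpa using norm_add_le (d t - 1) 1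
    constructor <;> nlinarith [abs_nonneg t]
  have ho : Tendsto (fun m : ℕ ↦ (m : ℝ) * ‖c (m : ℝ)⁻¹ - d (m : ℝ)⁻¹‖) atTop (𝓝 0) := by
    have h := (hcd.sub hdd).isLittleO
    simp only [sub_self, smul_zero, sub_zero, hc0, hd0, Pi.sub_apply] at h
    have h' := (h.comp_tendsto hinv).norm_left.tendsto_div_nhds_zero
    refine h'.congr fun m ↦ ?_
    simp [div_eq_mul_inv, mul_comm]
  have hdm : ∀ᶠ m : ℕ in atTop, d (m : ℝ)⁻¹ ^ m = exp (A + B) := by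
    filter_upwards [eventually_gt_atTop 0] with m hm
    have hm' : (m : ℝ) ≠ 0 := by positivity
    let _ : NormedAlgebra ℚ 𝔸 := NormedAlgebra.restrictScalars ℚ ℝ 𝔸
    rw [hd, ← exp_nsmul, ← Nat.cast_smul_eq_nsmul ℝ, smul_smul, mul_inv_cancel₀ hm', one_smul]
  have hlim : Tendsto (fun m : ℕ ↦ c (m : ℝ)⁻¹ ^ m - d (m : ℝ)⁻¹ ^ m) atTop (𝓝 0) := by
    refine squeeze_zero_norm' ?_ (by simpa using ho.mul_const (Real.exp K))
    filter_upwards [hinv.eventually hK, eventually_gt_atTop 0] with m hm hm0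
    have hm' : (0 : ℝ) < m := by positivity
    rw [abs_of_pos (inv_pos.2 hm')] at hm
    have hR : (1 + K * (m : ℝ)⁻¹) ^ m ≤ Real.exp K := by
      calc (1 + K * (m : ℝ)⁻¹) ^ m ≤ Real.exp (K * (m : ℝ)⁻¹) ^ m := by
            gcongr; rw [add_comm]; exact Real.add_one_le_exp _
        _ = Real.exp K := by rw [← Real.exp_nat_mul]; congr 1; field_simp
    have h1 : 1 ≤ 1 + K * (m : ℝ)⁻¹ := le_add_of_nonneg_right (by positivity)
    exact (norm_pow_sub_pow_le h1 hm.1 hm.2 m).trans (by gcongr)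
  have h := hlim.add (tendsto_const_nhds (x := exp (A + B)))
  rw [zero_add] at h
  refine h.congr' ?_
  filter_upwards [hdm] with m hm
  rw [hm, sub_add_cancel]

end LieTrotter

namespace Matrix

variable {ι : Type*} [Fintype ι]

lemma trace_mul_self_le_trace_mul_transpose (M : Matrix ι ι ℝ) :
    (M * M).trace ≤ (M * Mᵀ).trace := by
  simp only [trace, diag_apply, mul_apply, transpose_apply]
  have h : ∑ i, ∑ j, M i j * M j i ≤ ∑ i, ∑ j, (M i j * M i j + M j i * M j i) / 2 := by
    gcongr with i _ j _
    nlinarith [sq_nonneg (M i j - M j i)]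
  refine h.trans (le_of_eq ?_)
  simp only [add_div, Finset.sum_add_distrib]
  rw [Finset.sum_comm (f := fun i j ↦ M j i * M j i / 2)]
  simp only [← Finset.sum_add_distrib, add_halves]

variable [DecidableEq ι]

lemma trace_mul_pow_comm (A B : Matrix ι ι ℝ) (m : ℕ) :
    ((A * B) ^ m).trace = ((B * A) ^ m).trace := by
  cases m with
  | zero => simp
  | succ m => rw [pow_succ, ← mul_assoc, mul_pow_mul, mul_assoc, trace_mul_comm, mul_assoc, pow_succ]

/-- Two trace inequalities for powers `2 ^ k`, each of which feeds the induction step of the other: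
the first for `M²` and the second for `MᵀM`, `MMᵀ` give the first at the next exponent; the first
for `PQ` and the second for `P²`, `Q²` give the second. -/
lemma trace_pow_two_pow_le (k : ℕ) :
    (∀ M : Matrix ι ι ℝ, (M ^ 2 ^ (k + 1)).trace ≤ ((M * Mᵀ) ^ 2 ^ k).trace) ∧
    (∀ P Q : Matrix ι ι ℝ, P.IsSymm → Q.IsSymm →
      ((P * Q) ^ 2 ^ k).trace ≤ (P ^ 2 ^ k * Q ^ 2 ^ k).trace) := by
  induction k with
  | zero =>
    refine ⟨fun M ↦ ?_, fun P Q _ _ ↦ by simp⟩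
    simpa [pow_two] using trace_mul_self_le_trace_mul_transpose M
  | succ k ih =>
    obtain ⟨ih₁, ih₂⟩ := ih
    constructor
    · intro M
      have hP : (Mᵀ * M).IsSymm := by simp [IsSymm]
      have hQ : (M * Mᵀ).IsSymm := by simp [IsSymm]
      have e₁ : (M ^ 2 ^ (k + 2)).trace ≤ ((M * M * (M * M)ᵀ) ^ 2 ^ k).trace := by
        rw [pow_succ' 2 (k + 1), pow_mul, pow_two]
        exact ih₁ (M * M)
      have e₂ : ((M * M * (M * M)ᵀ) ^ 2 ^ k).trace = ((Mᵀ * M * (M * Mᵀ)) ^ 2 ^ k).trace := by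
        rw [transpose_mul, show M * M * (Mᵀ * Mᵀ) = (M * (M * Mᵀ)) * Mᵀ by noncomm_ring,
          trace_mul_pow_comm]
        congr 2; noncomm_ring
      have e₃ := ih₂ _ _ hP hQ
      -- arithmetic–geometric mean inequality for the trace inner product
      have e₄ : 2 * ((Mᵀ * M) ^ 2 ^ k * (M * Mᵀ) ^ 2 ^ k).trace
          ≤ ((Mᵀ * M) ^ 2 ^ (k + 1)).trace + ((M * Mᵀ) ^ 2 ^ (k + 1)).trace := by
        have hnn : 0 ≤ (((Mᵀ * M) ^ 2 ^ k - (M * Mᵀ) ^ 2 ^ k) *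
            ((Mᵀ * M) ^ 2 ^ k - (M * Mᵀ) ^ 2 ^ k)ᵀ).trace := by
          simp only [trace, diag_apply, mul_apply, transpose_apply]
          exact Finset.sum_nonneg fun i _ ↦ Finset.sum_nonneg fun j _ ↦ mul_self_nonneg _
        rw [transpose_sub, transpose_pow, transpose_pow, hP.eq, hQ.eq, sub_mul, mul_sub, mul_sub,
          trace_sub, trace_sub, trace_sub, ← pow_add, ← pow_add, ← two_mul, ← pow_succ',
          trace_mul_comm ((M * Mᵀ) ^ 2 ^ k)] at hnn
        linarith
      rw [trace_mul_pow_comm Mᵀ M] at e₄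
      linarith
    · intro P Q hP hQ
      have e₁ := ih₁ (P * Q)
      have e₂ : ((P * Q * (P * Q)ᵀ) ^ 2 ^ k).trace = ((P ^ 2 * Q ^ 2) ^ 2 ^ k).trace := by
        rw [transpose_mul, hP.eq, hQ.eq, show P * Q * (Q * P) = (P * (Q ^ 2)) * P by noncomm_ring,
          trace_mul_pow_comm]
        congr 2; noncomm_ring
      have e₃ := ih₂ _ _ (hP.pow 2) (hQ.pow 2)
      rw [← pow_mul, ← pow_mul, ← pow_succ'] at e₃
      linarith

open Filter Topology in
/-- The **Golden–Thompson inequality** for real symmetric matrices. -/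
theorem trace_exp_add_le {A B : Matrix ι ι ℝ} (hA : A.IsSymm) (hB : B.IsSymm) :
    (NormedSpace.exp (A + B)).trace ≤ (NormedSpace.exp A * NormedSpace.exp B).trace := by
  rcases isEmpty_or_nonempty ι with hι | hι
  · simp [trace]
  have h := (tendsto_exp_mul_exp_pow A B).comp (tendsto_pow_atTop_atTop_of_one_lt one_lt_two)
  have ht := ((continuous_id (X := Matrix ι ι ℝ)).matrix_trace.tendsto _).comp h
  refine le_of_tendsto ht (Eventually.of_forall fun k ↦ ?_)
  have hm : ((2 ^ k : ℕ) : ℝ) ≠ 0 := by positivity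
  have hpow (X : Matrix ι ι ℝ) :
      NormedSpace.exp (((2 ^ k : ℕ) : ℝ)⁻¹ • X) ^ 2 ^ k = NormedSpace.exp X := by
    rw [← Matrix.exp_nsmul, ← Nat.cast_smul_eq_nsmul ℝ, smul_smul, mul_inv_cancel₀ hm, one_smul]
  have := (trace_pow_two_pow_le k).2 _ _ (hA.smul (((2 ^ k : ℕ) : ℝ)⁻¹)).exp
    (hB.smul (((2 ^ k : ℕ) : ℝ)⁻¹)).exp
  rw [hpow, hpow] at this
  exact this

end Matrix

/-! ### Second-order upper bounds for the exponential -/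

lemma Real.exp_le_quadratic_of_nonpos {y : ℝ} (hy : y ≤ 0) : Real.exp y ≤ 1 + y + y ^ 2 / 2 := by
  have hd (t : ℝ) : HasDerivAt (fun t ↦ 1 + t + t ^ 2 / 2 - Real.exp t) (1 + t - Real.exp t) t := by
    have h := (((hasDerivAt_id t).const_add 1).add ((hasDerivAt_pow 2 t).div_const 2)).sub
      (Real.hasDerivAt_exp t)
    refine h.congr_deriv ?_
    simp
  have hanti : Antitone (fun t ↦ 1 + t + t ^ 2 / 2 - Real.exp t) :=
    antitone_of_hasDerivAt_nonpos hd fun t ↦ by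
      simpa [add_comm] using Real.add_one_le_exp t
  have := hanti hy
  simp at this
  linarith

lemma Real.exp_le_cubic_of_nonneg {y : ℝ} (hy : 0 ≤ y) :
    Real.exp y ≤ 1 + y + y ^ 2 / 2 + y ^ 3 / 6 * Real.exp y := by
  -- the inequality divided by `exp y`, whose difference has derivative `y² (1 - exp (-y)) / 2`
  have hd (t : ℝ) : HasDerivAt (fun t ↦ (1 + t + t ^ 2 / 2) * Real.exp (-t) + t ^ 3 / 6)
      (t ^ 2 / 2 * (1 - Real.exp (-t))) t := by
    have h₁ := ((hasDerivAt_id t).const_add 1).add ((hasDerivAt_pow 2 t).div_const 2)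
    have h₂ : HasDerivAt (fun t ↦ Real.exp (-t)) (Real.exp (-t) * -1) t :=
      (hasDerivAt_neg t).exp
    have h := (h₁.mul h₂).add ((hasDerivAt_pow 3 t).div_const 6)
    refine h.congr_deriv ?_
    simp
    ring
  have hmono : MonotoneOn (fun t ↦ (1 + t + t ^ 2 / 2) * Real.exp (-t) + t ^ 3 / 6)
      (Set.Ici 0) := by
    refine monotoneOn_of_hasDerivWithinAt_nonneg (convex_Ici 0)
      (fun t _ ↦ (hd t).continuousAt.continuousWithinAt) (fun t _ ↦ (hd t).hasDerivWithinAt) ?_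
    intro t ht
    have : Real.exp (-t) ≤ 1 := Real.exp_le_one_iff.2 (by
      rw [interior_Ici] at ht; exact neg_nonpos.2 (le_of_lt ht))
    exact mul_nonneg (by positivity) (by linarith)
  have h := hmono Set.self_mem_Ici (Set.mem_Ici.2 hy) hy
  have h1 : (1 : ℝ) ≤ (1 + y + y ^ 2 / 2) * Real.exp (-y) + y ^ 3 / 6 := by simpa using h
  calc Real.exp y = 1 * Real.exp y := (one_mul _).symm
    _ ≤ ((1 + y + y ^ 2 / 2) * Real.exp (-y) + y ^ 3 / 6) * Real.exp y := by gcongr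
    _ = (1 + y + y ^ 2 / 2) * (Real.exp (-y) * Real.exp y) + y ^ 3 / 6 * Real.exp y := by ring
    _ = _ := by rw [← Real.exp_add]; simp

/-- The coefficient `1 / 2 + (r / 6) exp r`, for which `exp y ≤ 1 + y + expCoeff r * y ^ 2` holds
whenever `y ≤ r`. The error of the quadratic Taylor polynomial is kept apart from the exact leading
term `1 / 2`. -/
noncomputable def expCoeff (r : ℝ) : ℝ := 1 / 2 + r / 6 * Real.exp r

lemma Real.exp_le_one_add_add_expCoeff_mul_sq {y r : ℝ} (hr : 0 ≤ r) (hy : y ≤ r) :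
    Real.exp y ≤ 1 + y + expCoeff r * y ^ 2 := by
  unfold expCoeff
  rcases le_total y 0 with h | h
  · have := Real.exp_le_quadratic_of_nonpos h
    have : 0 ≤ r / 6 * Real.exp r * y ^ 2 := by positivity
    linarith
  · have h₁ := Real.exp_le_cubic_of_nonneg h
    have h₂ : y ^ 3 / 6 * Real.exp y ≤ r / 6 * Real.exp r * y ^ 2 := by
      calc y ^ 3 / 6 * Real.exp y = y ^ 2 * (y / 6 * Real.exp y) := by ring
        _ ≤ y ^ 2 * (r / 6 * Real.exp r) := by gcongr
        _ = _ := by ring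
    linarith

namespace Matrix

variable {ι : Type*} [Fintype ι]

lemma trace_mul_mul_transpose (C W : Matrix ι ι ℝ) :
    (C * W * Cᵀ).trace = ∑ k, C.row k ⬝ᵥ W *ᵥ C.row k := by
  simp only [trace, diag_apply]
  refine Finset.sum_congr rfl fun k _ ↦ ?_
  rw [mul_assoc, mul_apply]
  simp only [dotProduct, mulVec, mul_apply, transpose_apply, row_apply]

variable [DecidableEq ι]

open scoped MatrixOrder in
lemma posSemidef_one_add_sub_exp {Y : Matrix ι ι ℝ} {r : ℝ} (hY : Y.IsSymm) (hr : 0 ≤ r)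
    (hYr : (r • (1 : Matrix ι ι ℝ) - Y).PosSemidef) :
    (1 + Y + expCoeff r • (Y * Y) - NormedSpace.exp Y).PosSemidef := by
  have hsa : IsSelfAdjoint Y := isHermitian_iff_isSymm.2 hY
  have hspec : ∀ y ∈ spectrum ℝ Y, y ≤ r := by
    rw [← le_algebraMap_iff_spectrum_le, Algebra.algebraMap_eq_smul_one]
    exact hYr
  have h : cfc Real.exp Y ≤ cfc (fun y ↦ 1 + y + expCoeff r * y ^ 2) Y :=
    cfc_mono (fun y hy ↦ Real.exp_le_one_add_add_expCoeff_mul_sq hr (hspec y hy))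
      (by fun_prop) (by fun_prop)
  rw [CFC.real_exp_eq_normedSpace_exp, cfc_add Y (fun y ↦ 1 + y) (fun y ↦ expCoeff r * y ^ 2),
    cfc_add Y (fun _ ↦ 1) (fun y ↦ y), cfc_const_one ℝ Y, cfc_id' ℝ Y,
    cfc_const_mul (expCoeff r) (fun y ↦ y ^ 2) Y, cfc_pow_id Y 2, pow_two] at h
  exact h

/-- A symmetric square root of the matrix exponential. -/
lemma exp_eq_mul_transpose {H : Matrix ι ι ℝ} (hH : H.IsSymm) :
    NormedSpace.exp H =
      NormedSpace.exp ((1 / 2 : ℝ) • H) * (NormedSpace.exp ((1 / 2 : ℝ) • H))ᵀ := by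
  rw [((hH.smul (1 / 2 : ℝ)).exp).eq, ← exp_add_of_commute _ _ (Commute.refl _), ← add_smul]
  norm_num

lemma trace_exp_eq_sum {H : Matrix ι ι ℝ} (hH : H.IsSymm) :
    (NormedSpace.exp H).trace =
      ∑ k, (NormedSpace.exp ((1 / 2 : ℝ) • H)).row k ⬝ᵥ
        (NormedSpace.exp ((1 / 2 : ℝ) • H)).row k := by
  have h := trace_mul_mul_transpose (NormedSpace.exp ((1 / 2 : ℝ) • H)) 1
  rw [mul_one] at h
  rw [exp_eq_mul_transpose hH, h]
  simp only [one_mulVec]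

lemma trace_exp_nonneg {H : Matrix ι ι ℝ} (hH : H.IsSymm) : 0 ≤ (NormedSpace.exp H).trace := by
  rw [trace_exp_eq_sum hH]
  exact Finset.sum_nonneg fun k _ ↦ Finset.sum_nonneg fun i _ ↦ mul_self_nonneg _

/-- The quadratic form of `1 + Y + expCoeff r • Y²` at `u`; it dominates that of `exp Y` when
`Y ≤ r`. -/
noncomputable def quadExpBound (Y : Matrix ι ι ℝ) (r : ℝ) (u : ι → ℝ) : ℝ :=
  u ⬝ᵥ u + u ⬝ᵥ Y *ᵥ u + expCoeff r * (Y *ᵥ u ⬝ᵥ Y *ᵥ u)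

/-- Golden–Thompson combined with the quadratic bound for `exp Y`: the increment `Y` enters only
through quadratic forms in vectors that depend on `H`. -/
lemma trace_exp_add_le_sum {H Y : Matrix ι ι ℝ} {r : ℝ} (hH : H.IsSymm) (hY : Y.IsSymm)
    (hr : 0 ≤ r) (hYr : (r • (1 : Matrix ι ι ℝ) - Y).PosSemidef) :
    (NormedSpace.exp (H + Y)).trace ≤
      ∑ k, quadExpBound Y r ((NormedSpace.exp ((1 / 2 : ℝ) • H)).row k) := by
  set C := NormedSpace.exp ((1 / 2 : ℝ) • H) with hC
  have hpos := ((posSemidef_one_add_sub_exp hY hr hYr).mul_mul_conjTranspose_same C).trace_nonneg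
  rw [conjTranspose_eq_transpose_of_trivial, mul_sub, sub_mul, trace_sub] at hpos
  have e : (NormedSpace.exp H * NormedSpace.exp Y).trace = (C * NormedSpace.exp Y * Cᵀ).trace := by
    have hCs : Cᵀ = C := ((hH.smul (1 / 2 : ℝ)).exp).eq
    rw [exp_eq_mul_transpose hH, ← hC, hCs, mul_assoc, trace_mul_comm]
  refine (trace_exp_add_le hH hY).trans ?_
  rw [e]
  refine (sub_nonneg.1 hpos).trans (le_of_eq ?_)
  rw [trace_mul_mul_transpose]
  refine Finset.sum_congr rfl fun k _ ↦ ?_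
  simp only [quadExpBound, add_mulVec, one_mulVec, smul_mulVec, dotProduct_add, dotProduct_smul, smul_eq_mul]
  rw [← mulVec_mulVec, dotProduct_mulVec (C.row k) Y (Y *ᵥ C.row k), ← mulVec_transpose, hY.eq]

lemma IsHermitian.trace_exp_smul {A : Matrix ι ι ℝ} (hA : A.IsHermitian) (t : ℝ) :
    (NormedSpace.exp (t • A)).trace = ∑ i, Real.exp (t * hA.eigenvalues i) := by
  let U : Matrix ι ι ℝ := hA.eigenvectorUnitary
  have hUU : U * star U = 1 := Unitary.coe_mul_star_self _
  have hUinv : U⁻¹ = star U := inv_eq_right_inv hUU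
  have hUunit : IsUnit U := IsUnit.of_mul_eq_one _ hUU
  have h : t • A = U * diagonal (fun i ↦ t * hA.eigenvalues i) * U⁻¹ := by
    conv_lhs => rw [hA.spectral_theorem]
    rw [Unitary.conjStarAlgAut_apply, hUinv, ← smul_mul_assoc, ← mul_smul_comm, ← diagonal_smul]
    rfl
  rw [h, exp_conj _ _ hUunit, trace_mul_comm, ← mul_assoc,
    nonsing_inv_mul _ ((isUnit_iff_isUnit_det _).1 hUunit), one_mul, exp_diagonal, trace_diagonal]
  simp [Pi.coe_exp, Real.exp_eq_exp_ℝ]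

lemma IsHermitian.norm_le_of_abs_eigenvalues_le {A : Matrix ι ι ℝ} (hA : A.IsHermitian) {t : ℝ}
    (ht : 0 ≤ t) (h : ∀ i, |hA.eigenvalues i| ≤ t) : ‖A‖ ≤ t := by
  rw [hA.spectral_theorem, Unitary.conjStarAlgAut_apply, ← Unitary.coe_star,
    CStarRing.norm_mul_coe_unitary, CStarRing.norm_coe_unitary_mul, l2_opNorm_diagonal,
    pi_norm_le_iff_of_nonneg ht]
  exact h

/-- The spectral norm exceeds `t` only if one of the two exponential traces is large. -/
lemma exp_lt_trace_exp_of_lt_norm {A : Matrix ι ι ℝ} (hA : A.IsSymm) {t θ : ℝ} (ht : 0 ≤ t)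
    (hθ : 0 < θ) (h : t < ‖A‖) :
    Real.exp (θ * t) ≤ (NormedSpace.exp (θ • A)).trace ∨
      Real.exp (θ * t) ≤ (NormedSpace.exp ((-θ) • A)).trace := by
  have hA' : A.IsHermitian := isHermitian_iff_isSymm.2 hA
  obtain ⟨i, hi⟩ : ∃ i, t < |hA'.eigenvalues i| := by
    by_contra! hc
    exact h.not_ge (hA'.norm_le_of_abs_eigenvalues_le ht hc)
  have hle (c : ℝ) : Real.exp (c * hA'.eigenvalues i) ≤ (NormedSpace.exp (c • A)).trace := by
    rw [hA'.trace_exp_smul]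
    exact Finset.single_le_sum (f := fun j ↦ Real.exp (c * hA'.eigenvalues j))
      (fun _ _ ↦ (Real.exp_pos _).le) (Finset.mem_univ i)
  rcases lt_abs.1 hi with hi | hi
  · exact Or.inl ((Real.exp_le_exp.2 (by gcongr)).trans (hle θ))
  · refine Or.inr ((Real.exp_le_exp.2 ?_).trans (hle (-θ)))
    rw [neg_mul, ← mul_neg]
    gcongr

end Matrix

/-! ### The matrix Laplace transform of a sum of i.i.d. matrices -/

namespace Matrix

variable {ι : Type*} [Fintype ι] [DecidableEq ι] {E : Type*} [MeasurableSpace E]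

/-- A bound on the mean of the quadratic forms `quadExpBound`, uniform in `u`, controls the factor by
which the exponential trace grows. With `∫⁻`, no integrability of `exp (H + Y)` has to be shown. -/
lemma lintegral_trace_exp_add_le {μ : Measure E} {Y : E → Matrix ι ι ℝ} {r : E → ℝ} {C : ℝ}
    (hY : ∀ x, (Y x).IsSymm) (hr : ∀ x, 0 ≤ r x)
    (hYr : ∀ x, (r x • (1 : Matrix ι ι ℝ) - Y x).PosSemidef)
    (hint : ∀ u, Integrable (fun x ↦ quadExpBound (Y x) (r x) u) μ)
    (hle : ∀ u, ∫ x, quadExpBound (Y x) (r x) u ∂μ ≤ C * (u ⬝ᵥ u))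
    {H : Matrix ι ι ℝ} (hH : H.IsSymm) :
    ∫⁻ x, ENNReal.ofReal (NormedSpace.exp (H + Y x)).trace ∂μ ≤
      ENNReal.ofReal (C * (NormedSpace.exp H).trace) := by
  have hbd (x : E) := trace_exp_add_le_sum hH (hY x) (hr x) (hYr x)
  have hi : Integrable
      (fun x ↦ ∑ k, quadExpBound (Y x) (r x) ((NormedSpace.exp ((1 / 2 : ℝ) • H)).row k)) μ :=
    integrable_finsetSum _ fun k _ ↦ hint _
  calc ∫⁻ x, ENNReal.ofReal (NormedSpace.exp (H + Y x)).trace ∂μ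
      ≤ ∫⁻ x, ENNReal.ofReal
          (∑ k, quadExpBound (Y x) (r x) ((NormedSpace.exp ((1 / 2 : ℝ) • H)).row k)) ∂μ :=
        lintegral_mono fun x ↦ ENNReal.ofReal_le_ofReal (hbd x)
    _ = ENNReal.ofReal
          (∫ x, ∑ k, quadExpBound (Y x) (r x) ((NormedSpace.exp ((1 / 2 : ℝ) • H)).row k) ∂μ) :=
        (ofReal_integral_eq_lintegral_ofReal hi <| Filter.Eventually.of_forall fun x ↦
          (trace_exp_nonneg (hH.add (hY x))).trans (hbd x)).symm
    _ ≤ _ := by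
        refine ENNReal.ofReal_le_ofReal ?_
        rw [integral_finsetSum _ fun k _ ↦ hint _, trace_exp_eq_sum hH, Finset.mul_sum]
        exact Finset.sum_le_sum fun k _ ↦ hle _

lemma continuous_trace_exp {X : Type*} [TopologicalSpace X] {Z : X → Matrix ι ι ℝ}
    (hZ : Continuous Z) : Continuous fun x ↦ (NormedSpace.exp (Z x)).trace := by
  have h : Continuous (NormedSpace.exp : Matrix ι ι ℝ → Matrix ι ι ℝ) := by
    let _ : NormedAlgebra ℚ (Matrix ι ι ℝ) := NormedAlgebra.restrictScalars ℚ ℝ _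
    exact NormedSpace.exp_continuous
  exact (h.comp hZ).matrix_trace

variable [TopologicalSpace E] [SecondCountableTopology E] [BorelSpace E]

/-- If adding one copy of the random matrix `Y` multiplies the exponential trace by at most `C` in
expectation, then adding `L` independent copies multiplies it by at most `C ^ L`. -/
lemma lintegral_pi_trace_exp_le {μ : Measure E} [IsProbabilityMeasure μ] {Y : E → Matrix ι ι ℝ}
    {C : ℝ} (hYc : Continuous Y) (hY : ∀ x, (Y x).IsSymm) (hC : 0 ≤ C)
    (hstep : ∀ H : Matrix ι ι ℝ, H.IsSymm →
      ∫⁻ x, ENNReal.ofReal (NormedSpace.exp (H + Y x)).trace ∂μ ≤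
        ENNReal.ofReal (C * (NormedSpace.exp H).trace))
    (L : ℕ) {H : Matrix ι ι ℝ} (hH : H.IsSymm) :
    ∫⁻ x : Fin L → E, ENNReal.ofReal (NormedSpace.exp (H + ∑ i, Y (x i))).trace
        ∂(Measure.pi fun _ ↦ μ) ≤ ENNReal.ofReal (C ^ L * (NormedSpace.exp H).trace) := by
  induction L generalizing H with
  | zero => simp
  | succ L ih =>
    have hmeas (K : ℕ) (G : Matrix ι ι ℝ) : Measurable fun x : Fin K → E ↦
        ENNReal.ofReal (NormedSpace.exp (G + ∑ i, Y (x i))).trace :=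
      (continuous_trace_exp (by fun_prop)).measurable.ennreal_ofReal
    have hmp := (measurePreserving_piFinSuccAbove (fun _ : Fin (L + 1) ↦ μ) 0).symm
    rw [← hmp.lintegral_comp (hmeas _ _)]
    refine (lintegral_prod _ ((hmeas (L + 1) H).comp hmp.measurable).aemeasurable).trans_le ?_
    calc ∫⁻ a, ∫⁻ y : Fin L → E, ENNReal.ofReal (NormedSpace.exp (H + ∑ i, Y
            ((MeasurableEquiv.piFinSuccAbove (fun _ ↦ E) 0).symm (a, y) i))).trace
            ∂(Measure.pi fun _ ↦ μ) ∂μ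
        = ∫⁻ a, ∫⁻ y : Fin L → E, ENNReal.ofReal
            (NormedSpace.exp ((H + Y a) + ∑ i, Y (y i))).trace ∂(Measure.pi fun _ ↦ μ) ∂μ := by
          simp only [Fin.sum_univ_succ, MeasurableEquiv.piFinSuccAbove_symm_apply,
            Fin.insertNthEquiv_apply, Fin.insertNth_zero, Fin.cons_zero, Fin.cons_succ, add_assoc,
            cast_eq]
      _ ≤ ∫⁻ a, ENNReal.ofReal (C ^ L * (NormedSpace.exp (H + Y a)).trace) ∂μ :=
          lintegral_mono fun a ↦ ih (hH.add (hY a))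
      _ = ENNReal.ofReal (C ^ L) * ∫⁻ a, ENNReal.ofReal (NormedSpace.exp (H + Y a)).trace ∂μ := by
          rw [← lintegral_const_mul]
          · simp only [ENNReal.ofReal_mul (pow_nonneg hC L)]
          · exact (continuous_trace_exp (by fun_prop)).measurable.ennreal_ofReal
      _ ≤ ENNReal.ofReal (C ^ L) * ENNReal.ofReal (C * (NormedSpace.exp H).trace) := by
          gcongr
          exact hstep H hH
      _ = _ := by
          rw [← ENNReal.ofReal_mul (pow_nonneg hC L), pow_succ, mul_assoc]

/-- The matrix Laplace transform method: a two-sided tail bound for the spectral norm of a sum of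
i.i.d. symmetric matrices `X (x i)`. -/
lemma measure_lt_norm_sum_le {μ : Measure E} [IsProbabilityMeasure μ] {X : E → Matrix ι ι ℝ}
    {C t θ : ℝ} (hXc : Continuous X) (hX : ∀ x, (X x).IsSymm) (hC : 0 ≤ C) (ht : 0 ≤ t)
    (hθ : 0 < θ)
    (hpos : ∀ H : Matrix ι ι ℝ, H.IsSymm →
      ∫⁻ x, ENNReal.ofReal (NormedSpace.exp (H + θ • X x)).trace ∂μ ≤
        ENNReal.ofReal (C * (NormedSpace.exp H).trace))
    (hneg : ∀ H : Matrix ι ι ℝ, H.IsSymm →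
      ∫⁻ x, ENNReal.ofReal (NormedSpace.exp (H + (-θ) • X x)).trace ∂μ ≤
        ENNReal.ofReal (C * (NormedSpace.exp H).trace))
    (L : ℕ) :
    (Measure.pi fun _ : Fin L ↦ μ).real {x | t < ‖∑ i, X (x i)‖} ≤
      2 * Fintype.card ι * (C ^ L * Real.exp (-(θ * t))) := by
  set ν := Measure.pi fun _ : Fin L ↦ μ with hν
  have hside (c : ℝ) (hc : ∀ H : Matrix ι ι ℝ, H.IsSymm →
      ∫⁻ x, ENNReal.ofReal (NormedSpace.exp (H + c • X x)).trace ∂μ ≤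
        ENNReal.ofReal (C * (NormedSpace.exp H).trace)) :
      ν.real {x | Real.exp (θ * t) ≤ (NormedSpace.exp (c • ∑ i, X (x i))).trace} ≤
        Fintype.card ι * (C ^ L * Real.exp (-(θ * t))) := by
    have h := lintegral_pi_trace_exp_le (Y := fun x ↦ c • X x) (by fun_prop)
      (fun x ↦ (hX x).smul c) hC hc L (H := 0) isSymm_zero
    simp only [zero_add, ← Finset.smul_sum, NormedSpace.exp_zero, trace_one] at h
    have hm : Measurable fun x : Fin L → E ↦
        ENNReal.ofReal (NormedSpace.exp (c • ∑ i, X (x i))).trace :=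
      (continuous_trace_exp (by fun_prop)).measurable.ennreal_ofReal
    have hmarkov := (mul_meas_ge_le_lintegral₀ hm.aemeasurable
      (ENNReal.ofReal (Real.exp (θ * t)))).trans h
    have hsub : {x : Fin L → E | Real.exp (θ * t) ≤ (NormedSpace.exp (c • ∑ i, X (x i))).trace} ⊆
        {x | ENNReal.ofReal (Real.exp (θ * t)) ≤
          ENNReal.ofReal (NormedSpace.exp (c • ∑ i, X (x i))).trace} :=
      fun x hx ↦ ENNReal.ofReal_le_ofReal hx
    have h' := ENNReal.toReal_mono ENNReal.ofReal_ne_top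
      ((mul_le_mul_right (measure_mono hsub) _).trans hmarkov)
    rw [ENNReal.toReal_mul, ENNReal.toReal_ofReal (Real.exp_pos _).le,
      ENNReal.toReal_ofReal (by positivity)] at h'
    rw [Real.exp_neg, ← mul_assoc, ← div_eq_mul_inv, le_div_iff₀ (Real.exp_pos _)]
    rw [mul_comm, mul_comm (Fintype.card ι : ℝ)]
    exact h'
  have hsub : {x : Fin L → E | t < ‖∑ i, X (x i)‖} ⊆
      {x | Real.exp (θ * t) ≤ (NormedSpace.exp (θ • ∑ i, X (x i))).trace} ∪
        {x | Real.exp (θ * t) ≤ (NormedSpace.exp ((-θ) • ∑ i, X (x i))).trace} :=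
    fun x hx ↦ exp_lt_trace_exp_of_lt_norm
      (by rw [IsSymm, transpose_sum]; exact Finset.sum_congr rfl fun i _ ↦ (hX (x i)).eq)
      ht hθ hx
  calc ν.real {x | t < ‖∑ i, X (x i)‖} ≤ _ := measureReal_mono hsub
    _ ≤ _ := measureReal_union_le _ _
    _ ≤ _ := add_le_add (hside θ hpos) (hside (-θ) hneg)
    _ = _ := by ring

end Matrix

/-! ### Moments of linear functionals of a Gaussian vector -/

namespace ProbabilityTheory

/-- Even moments of the standard Gaussian, tilted by `exp ((1 - q²) x² / 2)`. The tilt turns the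
density into that of a centred Gaussian of variance `q⁻²`; `q = 1` gives the plain moments. -/
lemma integral_pow_mul_exp_gaussianReal (k : ℕ) {q : ℝ} (hq : 0 < q) :
    Integrable (fun x : ℝ ↦ x ^ (2 * k) * Real.exp ((1 - q ^ 2) / 2 * x ^ 2)) (gaussianReal 0 1) ∧
      ∫ x, x ^ (2 * k) * Real.exp ((1 - q ^ 2) / 2 * x ^ 2) ∂(gaussianReal 0 1) =
        (2 * k - 1).doubleFactorial / q ^ (2 * k + 1) := by
  set b : ℝ := q ^ 2 / 2 with hb
  have hb0 : 0 < b := by positivity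
  have hdens (x : ℝ) : gaussianPDFReal 0 1 x • (x ^ (2 * k) * Real.exp ((1 - q ^ 2) / 2 * x ^ 2)) =
      (√(2 * Real.pi))⁻¹ * (x ^ (2 * k) * Real.exp (-b * x ^ 2)) := by
    have : Real.exp (-b * x ^ 2) =
        Real.exp (-x ^ 2 / 2) * Real.exp ((1 - q ^ 2) / 2 * x ^ 2) := by
      rw [← Real.exp_add, hb]; congr 1; ring
    rw [this, gaussianPDFReal]
    simp
    ring
  have hint : Integrable (fun x : ℝ ↦ x ^ (2 * k) * Real.exp (-b * x ^ 2)) := by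
    have h := integrable_rpow_mul_exp_neg_mul_sq hb0 (s := ((2 * k : ℕ) : ℝ))
      (by have : (0 : ℝ) ≤ ((2 * k : ℕ) : ℝ) := by positivity
          linarith)
    simpa only [Real.rpow_natCast] using h
  constructor
  · rw [gaussianReal_of_var_ne_zero 0 one_ne_zero, integrable_withDensity_iff_integrable_smul'
      (measurable_gaussianPDF 0 1) (Filter.Eventually.of_forall fun x ↦ gaussianPDF_lt_top)]
    simp only [toReal_gaussianPDF, hdens]
    exact hint.const_mul _
  · rw [integral_gaussianReal_eq_integral_smul one_ne_zero]
    simp only [hdens]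
    rw [integral_const_mul]
    have habs : ∫ x : ℝ, x ^ (2 * k) * Real.exp (-b * x ^ 2) =
        2 * ∫ x in Set.Ioi (0 : ℝ), x ^ (2 * k) * Real.exp (-b * x ^ 2) := by
      rw [← integral_comp_abs (f := fun x ↦ x ^ (2 * k) * Real.exp (-b * x ^ 2))]
      simp only [pow_mul, sq_abs]
    have hIoi : ∫ x in Set.Ioi (0 : ℝ), x ^ (2 * k) * Real.exp (-b * x ^ 2) =
        b ^ (-((k : ℝ) + 1 / 2)) * (1 / 2) * Real.Gamma (k + 1 / 2) := by
      have h := integral_rpow_mul_exp_neg_mul_rpow (p := 2) (q := ((2 * k : ℕ) : ℝ)) two_pos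
        (by have : (0 : ℝ) ≤ ((2 * k : ℕ) : ℝ) := by positivity
            linarith) hb0
      have e : (((2 * k : ℕ) : ℝ) + 1) / 2 = k + 1 / 2 := by push_cast; ring
      rw [neg_div, e] at h
      rw [← h]
      refine setIntegral_congr_fun measurableSet_Ioi fun x _ ↦ ?_
      simp only [Real.rpow_natCast, Real.rpow_two]
    have hpow : b ^ (-((k : ℝ) + 1 / 2)) = 2 ^ k * √2 / q ^ (2 * k + 1) := by
      rw [Real.rpow_neg hb0.le, Real.rpow_add hb0, Real.rpow_natCast, ← Real.sqrt_eq_rpow, hb,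
        Real.sqrt_div (sq_nonneg q), Real.sqrt_sq hq.le, div_pow, ← pow_mul, pow_succ]
      field_simp
    rw [habs, hIoi, hpow, Real.Gamma_nat_add_half, Real.sqrt_mul zero_le_two]
    field_simp

variable {ι : Type*} [Fintype ι]

lemma continuous_dotProduct_right (u : ι → ℝ) :
    Continuous fun x : EuclideanSpace ℝ ι ↦ x.ofLp ⬝ᵥ u := by
  unfold dotProduct
  fun_prop

variable [DecidableEq ι] {S : Matrix ι ι ℝ}

lemma map_dotProduct_multivariateGaussian (hS : S.PosSemidef) (u : ι → ℝ) :
    (multivariateGaussian 0 S).map (fun x ↦ x.ofLp ⬝ᵥ u) =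
      (gaussianReal 0 1).map (fun z ↦ √(u ⬝ᵥ S.mulVec u) * z) := by
  have hL : (fun x : EuclideanSpace ℝ ι ↦ x.ofLp ⬝ᵥ u) = innerSL ℝ (WithLp.toLp 2 u) := by
    ext x
    simp [EuclideanSpace.inner_eq_star_dotProduct]
  have hv : 0 ≤ u ⬝ᵥ S.mulVec u := by simpa using hS.dotProduct_mulVec_nonneg u
  have hvar : Var[innerSL ℝ (WithLp.toLp 2 u); multivariateGaussian 0 S] = u ⬝ᵥ S.mulVec u := by
    have h := covarianceBilin_multivariateGaussian (μ := 0) hS (WithLp.toLp 2 u) (WithLp.toLp 2 u)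
    rw [covarianceBilin_self IsGaussian.memLp_two_id] at h
    exact h
  have hmean : ∫ x, innerSL ℝ (WithLp.toLp 2 u) x ∂(multivariateGaussian 0 S) = 0 := by
    have h := (innerSL ℝ (WithLp.toLp 2 u)).integral_comp_comm
      (IsGaussian.integrable_fun_id (μ := multivariateGaussian 0 S))
    rw [integral_id_multivariateGaussian, map_zero] at h
    exact h
  rw [hL, IsGaussian.map_eq_gaussianReal, hvar, hmean, gaussianReal_map_const_mul, mul_zero, mul_one]
  congr 1
  ext
  simp [Real.coe_toNNReal _ hv, Real.sq_sqrt hv]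

lemma integral_comp_dotProduct (hS : S.PosSemidef) (u : ι → ℝ) {φ : ℝ → ℝ} (hφ : Continuous φ) :
    ∫ x, φ (x.ofLp ⬝ᵥ u) ∂(multivariateGaussian 0 S) =
      ∫ z, φ (√(u ⬝ᵥ S.mulVec u) * z) ∂(gaussianReal 0 1) := by
  rw [← integral_map (φ := fun x : EuclideanSpace ℝ ι ↦ x.ofLp ⬝ᵥ u)
    (continuous_dotProduct_right u).aemeasurable hφ.aestronglyMeasurable,
    map_dotProduct_multivariateGaussian hS u, integral_map (by fun_prop) hφ.aestronglyMeasurable]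

lemma integrable_comp_dotProduct_iff (hS : S.PosSemidef) (u : ι → ℝ) {φ : ℝ → ℝ}
    (hφ : Continuous φ) :
    Integrable (fun x ↦ φ (x.ofLp ⬝ᵥ u)) (multivariateGaussian 0 S) ↔
      Integrable (fun z ↦ φ (√(u ⬝ᵥ S.mulVec u) * z)) (gaussianReal 0 1) := by
  have h₁ := integrable_map_measure (μ := multivariateGaussian 0 S)
    (f := fun x : EuclideanSpace ℝ ι ↦ x.ofLp ⬝ᵥ u) hφ.aestronglyMeasurable
    (continuous_dotProduct_right u).aemeasurable
  have h₂ := integrable_map_measure (μ := gaussianReal 0 1)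
    (f := fun z ↦ √(u ⬝ᵥ S.mulVec u) * z) hφ.aestronglyMeasurable
    (by fun_prop : AEMeasurable (fun z ↦ √(u ⬝ᵥ S.mulVec u) * z) (gaussianReal 0 1))
  rw [map_dotProduct_multivariateGaussian hS u] at h₁
  exact h₁.symm.trans h₂

lemma integral_dotProduct_pow (hS : S.PosSemidef) (u : ι → ℝ) (k : ℕ) :
    Integrable (fun x ↦ (x.ofLp ⬝ᵥ u) ^ (2 * k)) (multivariateGaussian 0 S) ∧
      ∫ x, (x.ofLp ⬝ᵥ u) ^ (2 * k) ∂(multivariateGaussian 0 S) =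
        (2 * k - 1).doubleFactorial * (u ⬝ᵥ S.mulVec u) ^ k := by
  have hv : 0 ≤ u ⬝ᵥ S.mulVec u := by simpa using hS.dotProduct_mulVec_nonneg u
  have h := integral_pow_mul_exp_gaussianReal k one_pos
  simp only [one_pow, sub_self, zero_div, zero_mul, Real.exp_zero, mul_one, div_one] at h
  have e (z : ℝ) : (√(u ⬝ᵥ S.mulVec u) * z) ^ (2 * k) = (u ⬝ᵥ S.mulVec u) ^ k * z ^ (2 * k) := by
    rw [mul_pow, pow_mul √_, Real.sq_sqrt hv]
  refine ⟨(integrable_comp_dotProduct_iff hS u (φ := fun z ↦ z ^ (2 * k)) (by fun_prop)).2 ?_, ?_⟩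
  · simp only [e]
    exact h.1.const_mul _
  · rw [integral_comp_dotProduct hS u (φ := fun z ↦ z ^ (2 * k)) (by fun_prop)]
    simp only [e]
    rw [integral_const_mul, h.2, mul_comm]

lemma integral_dotProduct_mul_dotProduct (hS : S.PosSemidef) (u w : ι → ℝ) :
    Integrable (fun x ↦ (x.ofLp ⬝ᵥ u) * (x.ofLp ⬝ᵥ w)) (multivariateGaussian 0 S) ∧
      ∫ x, (x.ofLp ⬝ᵥ u) * (x.ofLp ⬝ᵥ w) ∂(multivariateGaussian 0 S) = u ⬝ᵥ S.mulVec w := by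
  have hp := integral_dotProduct_pow hS (u + w) 1
  have hm := integral_dotProduct_pow hS (u - w) 1
  have hsymm : w ⬝ᵥ S.mulVec u = u ⬝ᵥ S.mulVec w := by
    rw [Matrix.dotProduct_mulVec, ← Matrix.mulVec_transpose,
      (Matrix.isHermitian_iff_isSymm.1 hS.1).eq, dotProduct_comm]
  have e : (fun x : EuclideanSpace ℝ ι ↦ (x.ofLp ⬝ᵥ u) * (x.ofLp ⬝ᵥ w)) =
      fun x ↦ 1 / 4 * ((x.ofLp ⬝ᵥ (u + w)) ^ (2 * 1) - (x.ofLp ⬝ᵥ (u - w)) ^ (2 * 1)) := by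
    ext x
    rw [dotProduct_add, dotProduct_sub]
    ring
  rw [e]
  refine ⟨(hp.1.sub hm.1).const_mul _, ?_⟩
  rw [integral_const_mul, integral_sub hp.1 hm.1, hp.2, hm.2]
  simp only [Matrix.mulVec_add, Matrix.mulVec_sub, dotProduct_add, dotProduct_sub, add_dotProduct,
    sub_dotProduct, hsymm]
  norm_num
  ring

/-- Isserlis' formula for two linear functionals, by polarization of the fourth moment. -/
lemma integral_dotProduct_sq_mul_dotProduct_sq (hS : S.PosSemidef) (u w : ι → ℝ) :
    Integrable (fun x ↦ (x.ofLp ⬝ᵥ u) ^ 2 * (x.ofLp ⬝ᵥ w) ^ 2) (multivariateGaussian 0 S) ∧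
      ∫ x, (x.ofLp ⬝ᵥ u) ^ 2 * (x.ofLp ⬝ᵥ w) ^ 2 ∂(multivariateGaussian 0 S) =
        (u ⬝ᵥ S.mulVec u) * (w ⬝ᵥ S.mulVec w) + 2 * (u ⬝ᵥ S.mulVec w) ^ 2 := by
  have hp := integral_dotProduct_pow hS (u + w) 2
  have hm := integral_dotProduct_pow hS (u - w) 2
  have hu := integral_dotProduct_pow hS u 2
  have hw := integral_dotProduct_pow hS w 2
  have hsymm : w ⬝ᵥ S.mulVec u = u ⬝ᵥ S.mulVec w := by
    rw [Matrix.dotProduct_mulVec, ← Matrix.mulVec_transpose,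
      (Matrix.isHermitian_iff_isSymm.1 hS.1).eq, dotProduct_comm]
  have e : (fun x : EuclideanSpace ℝ ι ↦ (x.ofLp ⬝ᵥ u) ^ 2 * (x.ofLp ⬝ᵥ w) ^ 2) =
      fun x ↦ 1 / 12 * (((x.ofLp ⬝ᵥ (u + w)) ^ (2 * 2) + (x.ofLp ⬝ᵥ (u - w)) ^ (2 * 2)) -
        2 * ((x.ofLp ⬝ᵥ u) ^ (2 * 2) + (x.ofLp ⬝ᵥ w) ^ (2 * 2))) := by
    ext x
    rw [dotProduct_add, dotProduct_sub]
    ring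
  rw [e]
  have hi₁ : Integrable (fun x : EuclideanSpace ℝ ι ↦ (x.ofLp ⬝ᵥ (u + w)) ^ (2 * 2) +
      (x.ofLp ⬝ᵥ (u - w)) ^ (2 * 2)) (multivariateGaussian 0 S) := hp.1.add hm.1
  have hi₂ : Integrable (fun x : EuclideanSpace ℝ ι ↦ 2 * ((x.ofLp ⬝ᵥ u) ^ (2 * 2) +
      (x.ofLp ⬝ᵥ w) ^ (2 * 2))) (multivariateGaussian 0 S) := (hu.1.add hw.1).const_mul 2
  refine ⟨(hi₁.sub hi₂).const_mul _, ?_⟩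
  rw [integral_const_mul, integral_sub hi₁ hi₂, integral_add hp.1 hm.1, integral_const_mul,
    integral_add hu.1 hw.1, hp.2, hm.2, hu.2, hw.2]
  simp only [Matrix.mulVec_add, Matrix.mulVec_sub, dotProduct_add, dotProduct_sub, add_dotProduct,
    sub_dotProduct, hsymm]
  norm_num [Nat.doubleFactorial]
  ring

/-- The functional `x ↦ x ⬝ᵥ u` normalized to unit variance; it is `0` when the variance is `0`. -/
noncomputable def normalizedDot (S : Matrix ι ι ℝ) (u : ι → ℝ) (x : EuclideanSpace ℝ ι) : ℝ :=
  (x.ofLp ⬝ᵥ u) / √(u ⬝ᵥ S.mulVec u)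

lemma dotProduct_eq_sqrt_mul_normalizedDot (hS : S.PosSemidef) (u : ι → ℝ) :
    ∀ᵐ x ∂(multivariateGaussian 0 S),
      x.ofLp ⬝ᵥ u = √(u ⬝ᵥ S.mulVec u) * normalizedDot S u x := by
  rcases eq_or_ne (√(u ⬝ᵥ S.mulVec u)) 0 with h | h
  · have hmap := map_dotProduct_multivariateGaussian hS u
    have h0 : ∀ᵐ y ∂((gaussianReal 0 1).map (fun z ↦ √(u ⬝ᵥ S.mulVec u) * z)), y = 0 := by
      simp [h, ae_dirac_eq]
    rw [← hmap] at h0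
    filter_upwards [ae_of_ae_map (continuous_dotProduct_right u).aemeasurable h0] with x hx
    rw [hx, h, zero_mul]
  · refine Filter.Eventually.of_forall fun x ↦ ?_
    unfold normalizedDot
    field_simp

/-- An equality unless `x ⬝ᵥ u` is almost surely zero, when the left side vanishes. -/
lemma integral_comp_normalizedDot_le (hS : S.PosSemidef) (u : ι → ℝ) {φ : ℝ → ℝ}
    (hφ : Continuous φ) (hφ0 : φ 0 = 0) (hnn : ∀ z, 0 ≤ φ z)
    (hint : Integrable φ (gaussianReal 0 1)) :
    Integrable (fun x ↦ φ (normalizedDot S u x)) (multivariateGaussian 0 S) ∧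
      ∫ x, φ (normalizedDot S u x) ∂(multivariateGaussian 0 S) ≤
        ∫ z, φ z ∂(gaussianReal 0 1) := by
  have hc : Continuous fun y ↦ φ (y / √(u ⬝ᵥ S.mulVec u)) := by fun_prop
  have hi := integrable_comp_dotProduct_iff hS u hc
  have he := integral_comp_dotProduct hS u hc
  unfold normalizedDot
  rw [hi, he]
  rcases eq_or_ne (√(u ⬝ᵥ S.mulVec u)) 0 with h | h
  · simp only [h, div_zero, hφ0]
    exact ⟨by simp, by simpa using integral_nonneg hnn⟩
  · simp only [mul_div_cancel_left₀ _ h]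
    exact ⟨hint, le_rfl⟩

end ProbabilityTheory

/-! ### Tilted moments of the squared norm of a Gaussian vector -/

namespace ProbabilityTheory

/-- The exponent `k ≤ 3` is what lets all the moments needed share the bound
`(1 - 3 τ) ^ (-(k + 1 / 2)) ≤ (1 - 3 τ) ^ (-4)`. -/
lemma integral_pow_mul_exp_gaussianReal_le {k : ℕ} (hk : k ≤ 3) {τ : ℝ} (hτ : 0 ≤ τ)
    (hτ' : τ < 1 / 8) :
    Integrable (fun z : ℝ ↦ z ^ (2 * k) * Real.exp (3 * τ / 2 * z ^ 2)) (gaussianReal 0 1) ∧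
      ∫ z, z ^ (2 * k) * Real.exp (3 * τ / 2 * z ^ 2) ∂(gaussianReal 0 1) ≤
        (2 * k - 1).doubleFactorial / (1 - 3 * τ) ^ 4 := by
  have h0 : 0 < 1 - 3 * τ := by linarith
  have hq : 0 < √(1 - 3 * τ) := Real.sqrt_pos.2 h0
  have hq1 : √(1 - 3 * τ) ≤ 1 := Real.sqrt_le_one.2 (by linarith)
  have h := integral_pow_mul_exp_gaussianReal k hq
  have e : (1 - √(1 - 3 * τ) ^ 2) / 2 = 3 * τ / 2 := by rw [Real.sq_sqrt h0.le]; ring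
  rw [e] at h
  refine ⟨h.1, h.2.trans_le ?_⟩
  have h4 : (1 - 3 * τ) ^ 4 = √(1 - 3 * τ) ^ 8 := by
    rw [show (8 : ℕ) = 2 * 4 from rfl, pow_mul, Real.sq_sqrt h0.le]
  rw [h4]
  exact div_le_div_of_nonneg_left (by positivity) (by positivity)
    (pow_le_pow_of_le_one hq.le hq1 (by omega))

lemma convexOn_pow_mul_exp {θ : ℝ} (hθ : 0 ≤ θ) (k : ℕ) :
    ConvexOn ℝ (Set.Ici 0) fun r : ℝ ↦ r ^ k * Real.exp (θ * r) := by
  have hexp : ConvexOn ℝ (Set.Ici 0) fun r : ℝ ↦ Real.exp (θ * r) :=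
    (convexOn_exp.comp_linearMap (LinearMap.mulLeft ℝ θ)).subset (Set.subset_univ _)
      (convex_Ici 0)
  refine (convexOn_pow k).mul hexp (fun r hr ↦ pow_nonneg hr k) (fun r _ ↦ (Real.exp_pos _).le) ?_
  refine MonotoneOn.monovaryOn (fun a ha b _ hab ↦ pow_le_pow_left₀ ha hab k)
    (fun a _ b _ hab ↦ Real.exp_le_exp.2 (by gcongr))

variable {ι : Type*} [Fintype ι]

lemma continuous_dotProduct_self :
    Continuous fun x : EuclideanSpace ℝ ι ↦ x.ofLp ⬝ᵥ x.ofLp := by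
  unfold dotProduct
  fun_prop

/-- Jensen's inequality with weights `w j / T`: a function of the mixture `∑ j, w j * b j ^ 2` is
controlled by the same function of the single squares `T * b j ^ 2`. -/
lemma sum_pow_mul_exp_le {θ T : ℝ} (hθ : 0 ≤ θ) (hT : 0 < T) (k : ℕ) {w b : ι → ℝ}
    (hw : ∀ j, 0 ≤ w j) (hwT : ∑ j, w j = T) :
    (∑ j, w j * b j ^ 2) ^ k * Real.exp (θ * ∑ j, w j * b j ^ 2) ≤
      ∑ j, w j / T * ((T * b j ^ 2) ^ k * Real.exp (θ * T * b j ^ 2)) := by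
  have h := (convexOn_pow_mul_exp hθ k).map_sum_le (t := Finset.univ) (w := fun j ↦ w j / T)
    (p := fun j ↦ T * b j ^ 2) (fun j _ ↦ div_nonneg (hw j) hT.le)
    (by rw [← Finset.sum_div, hwT, div_self hT.ne']) (fun j _ ↦ Set.mem_Ici.2 (by positivity))
  have e (j : ι) : w j / T * (T * b j ^ 2) = w j * b j ^ 2 := by field_simp
  simp only [smul_eq_mul, e, ← mul_assoc θ] at h
  exact h

variable [DecidableEq ι] {S : Matrix ι ι ℝ}

lemma single_dotProduct_mulVec_single (j : ι) :
    Pi.single j 1 ⬝ᵥ S.mulVec (Pi.single j 1) = S j j := by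
  simp

lemma dotProduct_self_eq_sum_normalizedDot (hS : S.PosSemidef) :
    ∀ᵐ x ∂(multivariateGaussian 0 S),
      x.ofLp ⬝ᵥ x.ofLp = ∑ j, S j j * normalizedDot S (Pi.single j 1) x ^ 2 := by
  have h := ae_all_iff.2 fun j : ι ↦ dotProduct_eq_sqrt_mul_normalizedDot hS (Pi.single j 1)
  filter_upwards [h] with x hx
  refine Finset.sum_congr rfl fun j _ ↦ ?_
  have hj := hx j
  rw [single_dotProduct_mulVec_single, dotProduct_single, mul_one] at hj
  rw [hj, ← pow_two, mul_pow, Real.sq_sqrt (hS.diag_nonneg)]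

/-- The sixth-order tilted moment that governs the remainder. Jensen's inequality over the
coordinates reduces `‖x‖²` to the single squares, and Young's inequality separates `x ⬝ᵥ u` from each
coordinate, so that no information on their joint law is needed. -/
lemma integral_sq_mul_normSq_sq_mul_exp_le (hS : S.PosSemidef) (u : ι → ℝ) {θ : ℝ} (hθ : 0 ≤ θ)
    (hT : 0 < S.trace) (hτ : θ * S.trace < 1 / 8) :
    Integrable (fun x ↦ (x.ofLp ⬝ᵥ u) ^ 2 *
        ((x.ofLp ⬝ᵥ x.ofLp) ^ 2 * Real.exp (θ * (x.ofLp ⬝ᵥ x.ofLp)))) (multivariateGaussian 0 S) ∧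
      ∫ x, (x.ofLp ⬝ᵥ u) ^ 2 * ((x.ofLp ⬝ᵥ x.ofLp) ^ 2 * Real.exp (θ * (x.ofLp ⬝ᵥ x.ofLp)))
          ∂(multivariateGaussian 0 S) ≤
        (u ⬝ᵥ S.mulVec u) * S.trace ^ 2 * (5 + 10 / (1 - 3 * (θ * S.trace)) ^ 4) := by
  set T := S.trace with hTdef
  set v := u ⬝ᵥ S.mulVec u with hv
  have hv0 : 0 ≤ v := by simpa using hS.dotProduct_mulVec_nonneg u
  set τ := θ * T with hτdef
  have hτ0 : 0 ≤ τ := by positivity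
  have hcont : Continuous fun x : EuclideanSpace ℝ ι ↦ (x.ofLp ⬝ᵥ u) ^ 2 *
      ((x.ofLp ⬝ᵥ x.ofLp) ^ 2 * Real.exp (θ * (x.ofLp ⬝ᵥ x.ofLp))) := by
    have h₁ := continuous_dotProduct_right u
    have h₂ := continuous_dotProduct_self (ι := ι)
    fun_prop
  -- the two one-dimensional moments that remain after Jensen and Young
  have h6 := integral_pow_mul_exp_gaussianReal_le (k := 3) le_rfl le_rfl
    (by norm_num : (0 : ℝ) < 1 / 8)
  have h6τ := integral_pow_mul_exp_gaussianReal_le (k := 3) le_rfl hτ0 hτ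
  have hu := integral_comp_normalizedDot_le hS u (φ := fun z ↦ z ^ (2 * 3) *
    Real.exp (3 * 0 / 2 * z ^ 2)) (by fun_prop) (by simp) 
    (fun z ↦ by rw [pow_mul]; positivity) h6.1
  have hj (j : ι) := integral_comp_normalizedDot_le hS (Pi.single j 1) (φ := fun z ↦ z ^ (2 * 3) *
    Real.exp (3 * τ / 2 * z ^ 2)) (by fun_prop) (by simp) 
    (fun z ↦ by rw [pow_mul]; positivity) h6τ.1
  set A : EuclideanSpace ℝ ι → ℝ := fun x ↦ normalizedDot S u x ^ (2 * 3) *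
    Real.exp (3 * 0 / 2 * normalizedDot S u x ^ 2) with hA
  set B : ι → EuclideanSpace ℝ ι → ℝ := fun j x ↦ normalizedDot S (Pi.single j 1) x ^ (2 * 3) *
    Real.exp (3 * τ / 2 * normalizedDot S (Pi.single j 1) x ^ 2) with hB
  have hAi : Integrable A (multivariateGaussian 0 S) := hu.1
  have hBi (j : ι) : Integrable (B j) (multivariateGaussian 0 S) := (hj j).1
  have hterm (j : ι) : Integrable (fun x ↦ S j j / T * (v * T ^ 2 * ((A x + 2 * B j x) / 3)))
      (multivariateGaussian 0 S) :=
    (((hAi.add ((hBi j).const_mul 2)).div_const 3).const_mul _).const_mul _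
  have hbound : ∀ᵐ x ∂(multivariateGaussian 0 S), (x.ofLp ⬝ᵥ u) ^ 2 *
      ((x.ofLp ⬝ᵥ x.ofLp) ^ 2 * Real.exp (θ * (x.ofLp ⬝ᵥ x.ofLp))) ≤
        ∑ j, S j j / T * (v * T ^ 2 * ((A x + 2 * B j x) / 3)) := by
    filter_upwards [dotProduct_eq_sqrt_mul_normalizedDot hS u,
      dotProduct_self_eq_sum_normalizedDot hS] with x hx₁ hx₂
    rw [hx₁, hx₂, mul_pow, Real.sq_sqrt hv0]
    refine (mul_le_mul_of_nonneg_left (sum_pow_mul_exp_le hθ hT 2 (fun j ↦ hS.diag_nonneg) rfl)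
      (by positivity)).trans ?_
    rw [Finset.mul_sum]
    refine Finset.sum_le_sum fun j _ ↦ ?_
    set a := normalizedDot S u x
    set c := normalizedDot S (Pi.single j 1) x
    -- Young's inequality `a w² ≤ (a³ + 2 w³) / 3`, the exponential being shared out with `w`
    have hyoung (a w : ℝ) (ha : 0 ≤ a) (hw : 0 ≤ w) : a * w ^ 2 ≤ (a ^ 3 + 2 * w ^ 3) / 3 := by
      nlinarith [mul_nonneg (sq_nonneg (a - w)) (by positivity : 0 ≤ a + 2 * w)]
    have hy := hyoung (a ^ 2) (c ^ 2 * Real.exp (τ / 2 * c ^ 2)) (by positivity) (by positivity)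
    have e₂ : Real.exp (τ / 2 * c ^ 2) ^ 2 = Real.exp (τ * c ^ 2) := by
      rw [← Real.exp_nat_mul]; congr 1; push_cast; ring
    have e₃ : Real.exp (τ / 2 * c ^ 2) ^ 3 = Real.exp (3 * τ / 2 * c ^ 2) := by
      rw [← Real.exp_nat_mul]; congr 1; push_cast; ring
    rw [mul_pow, mul_pow, e₂, e₃, ← pow_mul, ← pow_mul, ← pow_mul] at hy
    have hAx : A x = a ^ (2 * 3) := by simp [hA, a]
    have hBx : B j x = c ^ (2 * 3) * Real.exp (3 * τ / 2 * c ^ 2) := rfl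
    rw [hAx, hBx]
    have hS0 : 0 ≤ S j j / T := div_nonneg hS.diag_nonneg hT.le
    calc v * a ^ 2 * (S j j / T * ((T * c ^ 2) ^ 2 * Real.exp (θ * T * c ^ 2)))
        = S j j / T * (v * T ^ 2 * (a ^ 2 * (c ^ (2 * 2) * Real.exp (τ * c ^ 2)))) := by
          rw [← hτdef]; ring
      _ ≤ _ := by gcongr
  have hint := Integrable.mono' (integrable_finsetSum Finset.univ fun j _ ↦ hterm j)
    hcont.aestronglyMeasurable (hbound.mono fun x hx ↦ by
      rwa [Real.norm_of_nonneg (by positivity)])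
  refine ⟨hint, ?_⟩
  refine (integral_mono_ae hint (integrable_finsetSum Finset.univ fun j _ ↦ hterm j)
    hbound).trans ?_
  rw [integral_finsetSum _ fun j _ ↦ hterm j]
  have hA15 : ∫ x, A x ∂(multivariateGaussian 0 S) ≤ 15 := by
    refine (hu.2.trans h6.2).trans (le_of_eq ?_)
    norm_num [Nat.doubleFactorial]
  have hB15 (j : ι) : ∫ x, B j x ∂(multivariateGaussian 0 S) ≤ 15 / (1 - 3 * τ) ^ 4 := by
    refine ((hj j).2.trans h6τ.2).trans (le_of_eq ?_)
    norm_num [Nat.doubleFactorial]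
  calc ∑ j, ∫ x, S j j / T * (v * T ^ 2 * ((A x + 2 * B j x) / 3)) ∂(multivariateGaussian 0 S)
      ≤ ∑ j, S j j / T * (v * T ^ 2 * (5 + 10 / (1 - 3 * τ) ^ 4)) := by
        refine Finset.sum_le_sum fun j _ ↦ ?_
        rw [integral_const_mul, integral_const_mul, integral_div,
          integral_add hAi ((hBi j).const_mul 2), integral_const_mul]
        have hS0 : 0 ≤ S j j / T := div_nonneg hS.diag_nonneg hT.le
        gcongr
        have := hB15 j
        have e : (10 : ℝ) / (1 - 3 * τ) ^ 4 = 2 / 3 * (15 / (1 - 3 * τ) ^ 4) := by ring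
        rw [e]
        linarith
    _ = _ := by
        rw [← Finset.sum_mul, ← Finset.sum_div]
        change T / T * _ = _
        rw [div_self hT.ne', one_mul]

lemma integral_normSq_mul_exp_le (hS : S.PosSemidef) {θ : ℝ} (hθ : 0 ≤ θ)
    (hT : 0 < S.trace) (hτ : θ * S.trace < 1 / 8) :
    Integrable (fun x ↦ (x.ofLp ⬝ᵥ x.ofLp) * Real.exp (θ * (x.ofLp ⬝ᵥ x.ofLp)))
        (multivariateGaussian 0 S) ∧
      ∫ x, (x.ofLp ⬝ᵥ x.ofLp) * Real.exp (θ * (x.ofLp ⬝ᵥ x.ofLp))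
          ∂(multivariateGaussian 0 S) ≤ S.trace * (1 / (1 - 3 * (θ * S.trace)) ^ 4) := by
  set T := S.trace with hTdef
  set τ := θ * T with hτdef
  have hτ0 : 0 ≤ τ := by positivity
  have hcont : Continuous fun x : EuclideanSpace ℝ ι ↦
      (x.ofLp ⬝ᵥ x.ofLp) * Real.exp (θ * (x.ofLp ⬝ᵥ x.ofLp)) := by
    have h₂ := continuous_dotProduct_self (ι := ι)
    fun_prop
  have h2τ := integral_pow_mul_exp_gaussianReal_le (k := 1) (by norm_num) hτ0 hτ
  have hj (j : ι) := integral_comp_normalizedDot_le hS (Pi.single j 1) (φ := fun z ↦ z ^ (2 * 1) *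
    Real.exp (3 * τ / 2 * z ^ 2)) (by fun_prop) (by simp)
    (fun z ↦ by rw [pow_mul]; positivity) h2τ.1
  set B : ι → EuclideanSpace ℝ ι → ℝ := fun j x ↦ normalizedDot S (Pi.single j 1) x ^ (2 * 1) *
    Real.exp (3 * τ / 2 * normalizedDot S (Pi.single j 1) x ^ 2) with hB
  have hBi (j : ι) : Integrable (B j) (multivariateGaussian 0 S) := (hj j).1
  have hterm (j : ι) : Integrable (fun x ↦ S j j / T * (T * B j x)) (multivariateGaussian 0 S) :=
    ((hBi j).const_mul _).const_mul _
  have hbound : ∀ᵐ x ∂(multivariateGaussian 0 S),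
      (x.ofLp ⬝ᵥ x.ofLp) * Real.exp (θ * (x.ofLp ⬝ᵥ x.ofLp)) ≤ ∑ j, S j j / T * (T * B j x) := by
    filter_upwards [dotProduct_self_eq_sum_normalizedDot hS] with x hx
    rw [hx]
    have h := sum_pow_mul_exp_le (b := fun j ↦ normalizedDot S (Pi.single j 1) x) hθ hT 1
      (fun j ↦ hS.diag_nonneg (i := j)) rfl
    rw [pow_one] at h
    refine h.trans (Finset.sum_le_sum fun j _ ↦ ?_)
    have hS0 : 0 ≤ S j j / T := div_nonneg hS.diag_nonneg hT.le
    simp only [hB, mul_one, pow_one, ← hτdef, mul_assoc T]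
    gcongr
    linarith
  have hint := Integrable.mono' (integrable_finsetSum Finset.univ fun j _ ↦ hterm j)
    hcont.aestronglyMeasurable (hbound.mono fun x hx ↦ by
      have hnn : 0 ≤ x.ofLp ⬝ᵥ x.ofLp := Finset.sum_nonneg fun i _ ↦ mul_self_nonneg _
      rwa [Real.norm_of_nonneg (by positivity)])
  refine ⟨hint, ?_⟩
  refine (integral_mono_ae hint (integrable_finsetSum Finset.univ fun j _ ↦ hterm j)
    hbound).trans ?_
  rw [integral_finsetSum _ fun j _ ↦ hterm j]
  have hB1 (j : ι) : ∫ x, B j x ∂(multivariateGaussian 0 S) ≤ 1 / (1 - 3 * τ) ^ 4 := by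
    refine ((hj j).2.trans h2τ.2).trans (le_of_eq ?_)
    norm_num [Nat.doubleFactorial]
  calc ∑ j, ∫ x, S j j / T * (T * B j x) ∂(multivariateGaussian 0 S)
      ≤ ∑ j, S j j / T * (T * (1 / (1 - 3 * τ) ^ 4)) := by
        refine Finset.sum_le_sum fun j _ ↦ ?_
        rw [integral_const_mul, integral_const_mul]
        have hS0 : 0 ≤ S j j / T := div_nonneg hS.diag_nonneg hT.le
        gcongr
        exact hB1 j
    _ = _ := by
        rw [← Finset.sum_mul, ← Finset.sum_div]
        change T / T * _ = _
        rw [div_self hT.ne', one_mul]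

end ProbabilityTheory

/-! ### Spectral norm and quadratic forms -/

namespace Matrix

variable {ι : Type*} [Fintype ι]

lemma dotProduct_self_eq_norm_sq (u : ι → ℝ) : u ⬝ᵥ u = ‖WithLp.toLp 2 u‖ ^ 2 := by
  rw [EuclideanSpace.real_norm_sq_eq]
  exact Finset.sum_congr rfl fun i _ ↦ (pow_two _).symm

lemma dotProduct_sq_le (u w : ι → ℝ) : (u ⬝ᵥ w) ^ 2 ≤ (u ⬝ᵥ u) * (w ⬝ᵥ w) := by
  simp only [dotProduct, ← pow_two]
  exact Finset.sum_mul_sq_le_sq_mul_sq _ _ _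

lemma posSemidef_vecMulVec_self (y : ι → ℝ) : (vecMulVec y y).PosSemidef := by
  simpa using posSemidef_vecMulVec_self_star y

variable [DecidableEq ι]

lemma mulVec_dotProduct_mulVec_le (A : Matrix ι ι ℝ) (u : ι → ℝ) :
    A *ᵥ u ⬝ᵥ A *ᵥ u ≤ ‖A‖ ^ 2 * (u ⬝ᵥ u) := by
  rw [dotProduct_self_eq_norm_sq, dotProduct_self_eq_norm_sq, ← mul_pow]
  exact pow_le_pow_left₀ (norm_nonneg _) (l2_opNorm_mulVec A (WithLp.toLp 2 u)) 2

lemma dotProduct_mulVec_le (A : Matrix ι ι ℝ) (u : ι → ℝ) : u ⬝ᵥ A *ᵥ u ≤ ‖A‖ * (u ⬝ᵥ u) := by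
  have huu : 0 ≤ u ⬝ᵥ u := Finset.sum_nonneg fun i _ ↦ mul_self_nonneg _
  refine le_of_sq_le_sq ?_ (by positivity)
  calc (u ⬝ᵥ A *ᵥ u) ^ 2 ≤ (u ⬝ᵥ u) * (A *ᵥ u ⬝ᵥ A *ᵥ u) := dotProduct_sq_le _ _
    _ ≤ (u ⬝ᵥ u) * (‖A‖ ^ 2 * (u ⬝ᵥ u)) := by
        gcongr
        exact mulVec_dotProduct_mulVec_le A u
    _ = _ := by ring

lemma PosSemidef.norm_le_trace {A : Matrix ι ι ℝ} (hA : A.PosSemidef) : ‖A‖ ≤ A.trace := by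
  refine hA.1.norm_le_of_abs_eigenvalues_le hA.trace_nonneg fun i ↦ ?_
  rw [abs_of_nonneg (hA.eigenvalues_nonneg i), hA.1.trace_eq_sum_eigenvalues]
  exact Finset.single_le_sum (f := fun j ↦ hA.1.eigenvalues j)
    (fun j _ ↦ hA.eigenvalues_nonneg j) (Finset.mem_univ i)

lemma posSemidef_norm_smul_one_sub {A : Matrix ι ι ℝ} (hA : A.IsSymm) :
    (‖A‖ • (1 : Matrix ι ι ℝ) - A).PosSemidef := by
  refine .of_dotProduct_mulVec_nonneg
    (isHermitian_iff_isSymm.2 ((isSymm_one.smul _).sub hA)) fun u ↦ ?_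
  simp only [star_trivial, sub_mulVec, smul_mulVec, one_mulVec, dotProduct_sub, dotProduct_smul,
    smul_eq_mul, sub_nonneg]
  exact dotProduct_mulVec_le A u

lemma posSemidef_smul_one_sub_vecMulVec (y : ι → ℝ) :
    ((y ⬝ᵥ y) • (1 : Matrix ι ι ℝ) - vecMulVec y y).PosSemidef := by
  refine .of_dotProduct_mulVec_nonneg (isHermitian_iff_isSymm.2 ((isSymm_one.smul _).sub
    (transpose_vecMulVec y y))) fun u ↦ ?_
  simp only [star_trivial, sub_mulVec, smul_mulVec, one_mulVec, vecMulVec_mulVec, dotProduct_sub,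
    dotProduct_smul, smul_eq_mul, sub_nonneg, MulOpposite.smul_eq_mul_unop, MulOpposite.unop_op]
  have := dotProduct_sq_le y u
  rw [dotProduct_comm u y]
  nlinarith

end Matrix

/-! ### Exponential moments of a centred Gaussian outer product -/

namespace ProbabilityTheory

open Matrix

variable {ι : Type*}

/-- The centred rank-one matrix `x xᵀ - S`. -/
def centeredOuter (S : Matrix ι ι ℝ) (x : EuclideanSpace ℝ ι) : Matrix ι ι ℝ :=
  vecMulVec x.ofLp x.ofLp - S

variable {S : Matrix ι ι ℝ}

lemma isSymm_centeredOuter (hS : S.IsSymm) (x : EuclideanSpace ℝ ι) :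
    (centeredOuter S x).IsSymm :=
  IsSymm.sub (transpose_vecMulVec _ _) hS

lemma continuous_centeredOuter : Continuous (centeredOuter S) := by
  unfold centeredOuter vecMulVec
  fun_prop

variable [Fintype ι]

lemma centeredOuter_mulVec (x : EuclideanSpace ℝ ι) (u : ι → ℝ) :
    centeredOuter S x *ᵥ u = (x.ofLp ⬝ᵥ u) • x.ofLp - S *ᵥ u := by
  rw [centeredOuter, sub_mulVec, vecMulVec_mulVec, op_smul_eq_smul]

lemma dotProduct_centeredOuter_mulVec (x : EuclideanSpace ℝ ι) (u : ι → ℝ) :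
    u ⬝ᵥ centeredOuter S x *ᵥ u = (x.ofLp ⬝ᵥ u) ^ 2 - u ⬝ᵥ S *ᵥ u := by
  rw [centeredOuter_mulVec, dotProduct_sub, dotProduct_smul, dotProduct_comm u x.ofLp, smul_eq_mul,
    pow_two]

lemma normSq_centeredOuter_mulVec_le (x : EuclideanSpace ℝ ι) (u : ι → ℝ) :
    centeredOuter S x *ᵥ u ⬝ᵥ centeredOuter S x *ᵥ u ≤
      2 * ((x.ofLp ⬝ᵥ u) ^ 2 * (x.ofLp ⬝ᵥ x.ofLp)) + 2 * (S *ᵥ u ⬝ᵥ S *ᵥ u) := by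
  rw [centeredOuter_mulVec]
  simp only [dotProduct, Finset.mul_sum, ← Finset.sum_add_distrib]
  refine Finset.sum_le_sum fun i _ ↦ ?_
  simp only [Pi.sub_apply, Pi.smul_apply, smul_eq_mul]
  nlinarith [sq_nonneg ((∑ j, x.ofLp j * u j) * x.ofLp i + (S *ᵥ u) i)]

variable [DecidableEq ι]

lemma integral_dotProduct_centeredOuter_mulVec (hS : S.PosSemidef) (u : ι → ℝ) :
    Integrable (fun x ↦ u ⬝ᵥ centeredOuter S x *ᵥ u) (multivariateGaussian 0 S) ∧
      ∫ x, u ⬝ᵥ centeredOuter S x *ᵥ u ∂(multivariateGaussian 0 S) = 0 := by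
  have h := integral_dotProduct_pow hS u 1
  simp only [mul_one] at h
  simp only [dotProduct_centeredOuter_mulVec]
  refine ⟨h.1.sub (integrable_const _), ?_⟩
  rw [integral_sub h.1 (integrable_const _), h.2]
  simp

lemma integral_normSq_centeredOuter_mulVec (hS : S.PosSemidef) (u : ι → ℝ) :
    Integrable (fun x ↦ centeredOuter S x *ᵥ u ⬝ᵥ centeredOuter S x *ᵥ u)
        (multivariateGaussian 0 S) ∧
      ∫ x, centeredOuter S x *ᵥ u ⬝ᵥ centeredOuter S x *ᵥ u ∂(multivariateGaussian 0 S) =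
        S.trace * (u ⬝ᵥ S *ᵥ u) + S *ᵥ u ⬝ᵥ S *ᵥ u := by
  have h₁ (i : ι) := integral_dotProduct_sq_mul_dotProduct_sq hS (Pi.single i 1) u
  have h₂ (i : ι) := integral_dotProduct_mul_dotProduct hS (Pi.single i 1) u
  simp only [dotProduct_single, single_dotProduct, mul_one, one_mul, mulVec_single_one, col_apply]
    at h₁ h₂
  have e : (fun x : EuclideanSpace ℝ ι ↦
      centeredOuter S x *ᵥ u ⬝ᵥ centeredOuter S x *ᵥ u) = fun x ↦ ∑ i,
        (x.ofLp i ^ 2 * (x.ofLp ⬝ᵥ u) ^ 2 - 2 * (S *ᵥ u) i * (x.ofLp i * (x.ofLp ⬝ᵥ u)) +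
          (S *ᵥ u) i ^ 2) := by
    ext x
    rw [centeredOuter_mulVec, dotProduct]
    refine Finset.sum_congr rfl fun i _ ↦ ?_
    simp only [Pi.sub_apply, Pi.smul_apply, smul_eq_mul]
    ring
  have hi₁ (i : ι) : Integrable (fun x : EuclideanSpace ℝ ι ↦ x.ofLp i ^ 2 * (x.ofLp ⬝ᵥ u) ^ 2 -
      2 * (S *ᵥ u) i * (x.ofLp i * (x.ofLp ⬝ᵥ u))) (multivariateGaussian 0 S) :=
    (h₁ i).1.sub ((h₂ i).1.const_mul _)
  have hi (i : ι) : Integrable (fun x : EuclideanSpace ℝ ι ↦ x.ofLp i ^ 2 * (x.ofLp ⬝ᵥ u) ^ 2 -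
      2 * (S *ᵥ u) i * (x.ofLp i * (x.ofLp ⬝ᵥ u)) + (S *ᵥ u) i ^ 2) (multivariateGaussian 0 S) :=
    (hi₁ i).add (integrable_const _)
  rw [e]
  refine ⟨integrable_finsetSum _ fun i _ ↦ hi i, ?_⟩
  rw [integral_finsetSum _ fun i _ ↦ hi i, trace, Finset.sum_mul,
    show S *ᵥ u ⬝ᵥ S *ᵥ u = ∑ i, (S *ᵥ u) i * (S *ᵥ u) i from rfl, ← Finset.sum_add_distrib]
  refine Finset.sum_congr rfl fun i _ ↦ ?_
  rw [integral_add (hi₁ i) (integrable_const _), integral_sub (h₁ i).1 ((h₂ i).1.const_mul _),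
    integral_const_mul, (h₁ i).2, (h₂ i).2]
  simp
  ring

/-- The variance proxy: the second moment of `(x xᵀ - S) u` is at most `2 tr S ‖S‖ ‖u‖²`. -/
lemma variance_proxy_le (hS : S.PosSemidef) (u : ι → ℝ) :
    S.trace * (u ⬝ᵥ S *ᵥ u) + S *ᵥ u ⬝ᵥ S *ᵥ u ≤ 2 * (S.trace * ‖S‖) * (u ⬝ᵥ u) := by
  have h₁ := mul_le_mul_of_nonneg_left (dotProduct_mulVec_le S u) hS.trace_nonneg
  have h₂ := mulVec_dotProduct_mulVec_le S u
  have huu : 0 ≤ u ⬝ᵥ u := Finset.sum_nonneg fun i _ ↦ mul_self_nonneg _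
  have h₃ : ‖S‖ ^ 2 * (u ⬝ᵥ u) ≤ S.trace * ‖S‖ * (u ⬝ᵥ u) := by
    rw [pow_two]
    gcongr
    exact hS.norm_le_trace
  linarith

lemma remainder_const_le {τ : ℝ} (hτ : 0 ≤ τ) (hτ' : τ < 1 / 8) :
    1 + τ / 3 * (5 + 11 / (1 - 3 * τ) ^ 4) ≤ 1 / (1 - 8 * τ) := by
  have h8 : 0 < 1 - 8 * τ := by linarith
  have hq : 0 < (1 - 3 * τ) ^ 4 := pow_pos (by linarith) 4
  -- `(1 - 3τ)⁴` lies above its tangent at `τ = 1/18`, where `(1 - 8τ) / (1 - 3τ)⁴` is maximal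
  have h1 : 1 - 8 * τ ≤ 6 / 5 * (1 - 3 * τ) ^ 4 := by
    have h2 : (25 / 36 : ℝ) - 5 * (τ - 1 / 18) ≤ (1 - 3 * τ) ^ 2 := by
      nlinarith [sq_nonneg (τ - 1 / 18)]
    have h3 : (1 - 3 * τ) ^ 4 ≥
        (25 / 36 : ℝ) ^ 2 + 2 * (25 / 36) * ((1 - 3 * τ) ^ 2 - 25 / 36) := by
      nlinarith [sq_nonneg ((1 - 3 * τ) ^ 2 - 25 / 36)]
    linarith
  have h4 : (1 - 8 * τ) * (11 / (1 - 3 * τ) ^ 4) ≤ 66 / 5 := by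
    rw [mul_div_assoc', div_le_iff₀ hq]
    linarith
  rw [le_div_iff₀ h8]
  nlinarith

/-- The remainder beyond the quadratic Taylor polynomial. Only here is `‖(x xᵀ - S) u‖²` estimated
crudely; the factor `θ³` in front of it leaves room for the loss. -/
lemma integral_remainder_le (hS : S.PosSemidef) (u : ι → ℝ) {θ : ℝ} (hθ : 0 ≤ θ)
    (hT : 0 < S.trace) (hτ : θ * S.trace < 1 / 8) :
    Integrable (fun x ↦ (x.ofLp ⬝ᵥ x.ofLp) * Real.exp (θ * (x.ofLp ⬝ᵥ x.ofLp)) *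
        (centeredOuter S x *ᵥ u ⬝ᵥ centeredOuter S x *ᵥ u)) (multivariateGaussian 0 S) ∧
      ∫ x, (x.ofLp ⬝ᵥ x.ofLp) * Real.exp (θ * (x.ofLp ⬝ᵥ x.ofLp)) *
          (centeredOuter S x *ᵥ u ⬝ᵥ centeredOuter S x *ᵥ u) ∂(multivariateGaussian 0 S) ≤
        2 * (S.trace ^ 2 * ‖S‖ * (u ⬝ᵥ u)) * (5 + 11 / (1 - 3 * (θ * S.trace)) ^ 4) := by
  have hnn (y : ι → ℝ) : 0 ≤ y ⬝ᵥ y := Finset.sum_nonneg fun i _ ↦ mul_self_nonneg _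
  obtain ⟨hai, ha⟩ := integral_sq_mul_normSq_sq_mul_exp_le hS u hθ hT hτ
  obtain ⟨hbi, hb⟩ := integral_normSq_mul_exp_le hS hθ hT hτ
  set T := S.trace
  set D := (1 - 3 * (θ * T)) ^ 4
  have hD : 0 ≤ D := by positivity
  set G : EuclideanSpace ℝ ι → ℝ := fun x ↦
    2 * ((x.ofLp ⬝ᵥ u) ^ 2 * ((x.ofLp ⬝ᵥ x.ofLp) ^ 2 * Real.exp (θ * (x.ofLp ⬝ᵥ x.ofLp)))) +
      2 * (S *ᵥ u ⬝ᵥ S *ᵥ u) * ((x.ofLp ⬝ᵥ x.ofLp) * Real.exp (θ * (x.ofLp ⬝ᵥ x.ofLp))) with hG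
  have hGi : Integrable G (multivariateGaussian 0 S) :=
    (hai.const_mul 2).add (hbi.const_mul _)
  have hRG (x : EuclideanSpace ℝ ι) : (x.ofLp ⬝ᵥ x.ofLp) * Real.exp (θ * (x.ofLp ⬝ᵥ x.ofLp)) *
      (centeredOuter S x *ᵥ u ⬝ᵥ centeredOuter S x *ᵥ u) ≤ G x := by
    have h := mul_le_mul_of_nonneg_left (normSq_centeredOuter_mulVec_le (S := S) x u)
      (mul_nonneg (hnn x.ofLp) (Real.exp_pos (θ * (x.ofLp ⬝ᵥ x.ofLp))).le)
    refine h.trans (le_of_eq ?_)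
    simp only [hG]
    ring
  have hRc : Continuous fun x : EuclideanSpace ℝ ι ↦
      (x.ofLp ⬝ᵥ x.ofLp) * Real.exp (θ * (x.ofLp ⬝ᵥ x.ofLp)) *
        (centeredOuter S x *ᵥ u ⬝ᵥ centeredOuter S x *ᵥ u) := by
    have h₁ := continuous_dotProduct_self (ι := ι)
    have h₂ : Continuous fun x : EuclideanSpace ℝ ι ↦ centeredOuter S x *ᵥ u :=
      continuous_centeredOuter.matrix_mulVec continuous_const
    exact (h₁.mul (Real.continuous_exp.comp (h₁.const_mul θ))).mul (h₂.dotProduct h₂)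
  have hRi := hGi.mono' (f := fun x : EuclideanSpace ℝ ι ↦
      (x.ofLp ⬝ᵥ x.ofLp) * Real.exp (θ * (x.ofLp ⬝ᵥ x.ofLp)) *
        (centeredOuter S x *ᵥ u ⬝ᵥ centeredOuter S x *ᵥ u)) hRc.aestronglyMeasurable
    (Filter.Eventually.of_forall fun x ↦ by
      rw [Real.norm_of_nonneg (mul_nonneg (mul_nonneg (hnn _) (Real.exp_pos _).le) (hnn _))]
      exact hRG x)
  refine ⟨hRi, (integral_mono hRi hGi hRG).trans ?_⟩
  rw [hG, integral_add (hai.const_mul 2) (hbi.const_mul _), integral_const_mul, integral_const_mul]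
  have e₁ : (u ⬝ᵥ S *ᵥ u) * T ^ 2 * (5 + 10 / D) ≤ ‖S‖ * (u ⬝ᵥ u) * T ^ 2 * (5 + 10 / D) :=
    mul_le_mul_of_nonneg_right (mul_le_mul_of_nonneg_right (dotProduct_mulVec_le S u)
      (sq_nonneg T)) (by positivity)
  have e₂ : S *ᵥ u ⬝ᵥ S *ᵥ u ≤ T * ‖S‖ * (u ⬝ᵥ u) := by
    refine (mulVec_dotProduct_mulVec_le S u).trans ?_
    rw [pow_two]
    exact mul_le_mul_of_nonneg_right
      (mul_le_mul_of_nonneg_right hS.norm_le_trace (norm_nonneg S)) (hnn u)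
  have e₃ := mul_le_mul e₂ hb
    (integral_nonneg fun x ↦ mul_nonneg (hnn x.ofLp) (Real.exp_pos _).le)
    (mul_nonneg (mul_nonneg hT.le (norm_nonneg S)) (hnn u))
  have e₄ := ha.trans e₁
  have e₅ : 2 * (T ^ 2 * ‖S‖ * (u ⬝ᵥ u)) * (5 + 11 / D) =
      2 * (‖S‖ * (u ⬝ᵥ u) * T ^ 2 * (5 + 10 / D)) + 2 * (T * ‖S‖ * (u ⬝ᵥ u) * (T * (1 / D))) := by
    ring
  rw [e₅, mul_assoc 2 (S *ᵥ u ⬝ᵥ S *ᵥ u)]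
  exact add_le_add (mul_le_mul_of_nonneg_left e₄ zero_le_two)
    (mul_le_mul_of_nonneg_left e₃ zero_le_two)

lemma integral_quadExpBound_smul_centeredOuter_le (hS : S.PosSemidef) (u : ι → ℝ) {θ : ℝ}
    (hθ : 0 ≤ θ) (hT : 0 < S.trace) (hτ : θ * S.trace < 1 / 8) :
    Integrable (fun x ↦ quadExpBound (θ • centeredOuter S x) (θ * (x.ofLp ⬝ᵥ x.ofLp)) u)
        (multivariateGaussian 0 S) ∧
      ∫ x, quadExpBound (θ • centeredOuter S x) (θ * (x.ofLp ⬝ᵥ x.ofLp)) u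
          ∂(multivariateGaussian 0 S) ≤
        (1 + θ ^ 2 * (S.trace * ‖S‖) / (1 - 8 * (θ * S.trace))) * (u ⬝ᵥ u) := by
  have huu : 0 ≤ u ⬝ᵥ u := Finset.sum_nonneg fun i _ ↦ mul_self_nonneg _
  -- decomposition into the Taylor polynomial, whose mean is explicit, and a remainder
  have hdecomp (x : EuclideanSpace ℝ ι) :
      quadExpBound (θ • centeredOuter S x) (θ * (x.ofLp ⬝ᵥ x.ofLp)) u =
        (u ⬝ᵥ u + θ * (u ⬝ᵥ centeredOuter S x *ᵥ u) + θ ^ 2 / 2 *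
          (centeredOuter S x *ᵥ u ⬝ᵥ centeredOuter S x *ᵥ u)) +
        θ ^ 3 / 6 * ((x.ofLp ⬝ᵥ x.ofLp) * Real.exp (θ * (x.ofLp ⬝ᵥ x.ofLp)) *
          (centeredOuter S x *ᵥ u ⬝ᵥ centeredOuter S x *ᵥ u)) := by
    simp only [quadExpBound, expCoeff, smul_mulVec, dotProduct_smul, smul_dotProduct, smul_eq_mul]
    ring
  obtain ⟨h1i, h1⟩ := integral_dotProduct_centeredOuter_mulVec hS u
  obtain ⟨h2i, h2⟩ := integral_normSq_centeredOuter_mulVec hS u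
  obtain ⟨hRi, hR⟩ := integral_remainder_le hS u hθ hT hτ
  have hPi' : Integrable (fun x ↦ u ⬝ᵥ u + θ * (u ⬝ᵥ centeredOuter S x *ᵥ u))
      (multivariateGaussian 0 S) := (integrable_const _).add (h1i.const_mul _)
  have hPi : Integrable (fun x ↦ u ⬝ᵥ u + θ * (u ⬝ᵥ centeredOuter S x *ᵥ u) + θ ^ 2 / 2 *
      (centeredOuter S x *ᵥ u ⬝ᵥ centeredOuter S x *ᵥ u)) (multivariateGaussian 0 S) :=
    hPi'.add (h2i.const_mul _)
  simp only [hdecomp]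
  refine ⟨hPi.add (hRi.const_mul _), ?_⟩
  rw [integral_add hPi (hRi.const_mul _), integral_add hPi' (h2i.const_mul _),
    integral_add (integrable_const _) (h1i.const_mul _), integral_const_mul, integral_const_mul,
    integral_const_mul, h1, h2]
  have hvar := mul_le_mul_of_nonneg_left (variance_proxy_le hS u) (by positivity : 0 ≤ θ ^ 2 / 2)
  have hrem := mul_le_mul_of_nonneg_left hR (by positivity : 0 ≤ θ ^ 3 / 6)
  have hc := mul_le_mul_of_nonneg_left (remainder_const_le (mul_nonneg hθ hT.le) hτ)
    (mul_nonneg (mul_nonneg (sq_nonneg θ) (mul_nonneg hT.le (norm_nonneg S))) huu)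
  simp only [integral_const, probReal_univ, one_smul, mul_zero, add_zero]
  refine (add_le_add (add_le_add_right hvar _) hrem).trans ?_
  calc _ = u ⬝ᵥ u + θ ^ 2 * (S.trace * ‖S‖) * (u ⬝ᵥ u) *
        (1 + θ * S.trace / 3 * (5 + 11 / (1 - 3 * (θ * S.trace)) ^ 4)) := by ring
    _ ≤ _ := add_le_add_right hc _
    _ = _ := by ring

lemma posSemidef_smul_one_sub_smul_centeredOuter (hS : S.PosSemidef) {θ : ℝ} (hθ : 0 ≤ θ)
    (x : EuclideanSpace ℝ ι) :
    ((θ * (x.ofLp ⬝ᵥ x.ofLp)) • (1 : Matrix ι ι ℝ) - θ • centeredOuter S x).PosSemidef := by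
  have h := ((posSemidef_smul_one_sub_vecMulVec x.ofLp).add hS).smul hθ
  rwa [sub_add, smul_sub, smul_smul] at h

/-- On the positive side `x xᵀ - S ≤ ‖x‖²`, so the exponent is bounded above by a random scalar whose
tilted moments are finite. -/
lemma lintegral_trace_exp_smul_centeredOuter_le (hS : S.PosSemidef) {θ : ℝ} (hθ : 0 ≤ θ)
    (hT : 0 < S.trace) (hτ : θ * S.trace < 1 / 8) {H : Matrix ι ι ℝ} (hH : H.IsSymm) :
    ∫⁻ x, ENNReal.ofReal (NormedSpace.exp (H + θ • centeredOuter S x)).trace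
        ∂(multivariateGaussian 0 S) ≤
      ENNReal.ofReal ((1 + θ ^ 2 * (S.trace * ‖S‖) / (1 - 8 * (θ * S.trace))) *
        (NormedSpace.exp H).trace) := by
  have hSs : S.IsSymm := isHermitian_iff_isSymm.1 hS.1
  have hnn (y : ι → ℝ) : 0 ≤ y ⬝ᵥ y := Finset.sum_nonneg fun i _ ↦ mul_self_nonneg _
  exact lintegral_trace_exp_add_le (μ := multivariateGaussian 0 S)
    (Y := fun x ↦ θ • centeredOuter S x) (r := fun x ↦ θ * (x.ofLp ⬝ᵥ x.ofLp))
    (C := 1 + θ ^ 2 * (S.trace * ‖S‖) / (1 - 8 * (θ * S.trace)))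
    (fun x ↦ (isSymm_centeredOuter hSs x).smul θ) (fun x ↦ mul_nonneg hθ (hnn x.ofLp))
    (fun x ↦ posSemidef_smul_one_sub_smul_centeredOuter hS hθ x)
    (fun u ↦ (integral_quadExpBound_smul_centeredOuter_le hS u hθ hT hτ).1)
    (fun u ↦ (integral_quadExpBound_smul_centeredOuter_le hS u hθ hT hτ).2) hH

lemma two_mul_expCoeff_le {r τ : ℝ} (hr : 0 ≤ r) (hrτ : r ≤ τ) (hτ : τ < 1 / 8) :
    2 * expCoeff r ≤ 1 / (1 - 8 * τ) := by
  have hexp : Real.exp r ≤ 3 :=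
    (Real.exp_le_exp.2 (by linarith : r ≤ 1)).trans (by linarith [Real.exp_one_lt_d9])
  have h1 : 2 * expCoeff r ≤ 1 + 8 * τ := by
    unfold expCoeff
    have : r / 6 * Real.exp r ≤ r / 6 * 3 := by gcongr
    linarith
  refine h1.trans ?_
  rw [le_div_iff₀ (by linarith)]
  nlinarith

lemma integral_quadExpBound_neg_smul_centeredOuter_le (hS : S.PosSemidef) (u : ι → ℝ) {θ : ℝ}
    (hθ : 0 ≤ θ) (hτ : θ * S.trace < 1 / 8) :
    Integrable (fun x ↦ quadExpBound ((-θ) • centeredOuter S x) (θ * ‖S‖) u)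
        (multivariateGaussian 0 S) ∧
      ∫ x, quadExpBound ((-θ) • centeredOuter S x) (θ * ‖S‖) u ∂(multivariateGaussian 0 S) ≤
        (1 + θ ^ 2 * (S.trace * ‖S‖) / (1 - 8 * (θ * S.trace))) * (u ⬝ᵥ u) := by
  have huu : 0 ≤ u ⬝ᵥ u := Finset.sum_nonneg fun i _ ↦ mul_self_nonneg _
  have hr0 : 0 ≤ θ * ‖S‖ := by positivity
  have hdecomp (x : EuclideanSpace ℝ ι) :
      quadExpBound ((-θ) • centeredOuter S x) (θ * ‖S‖) u =
        u ⬝ᵥ u + (-θ) * (u ⬝ᵥ centeredOuter S x *ᵥ u) + expCoeff (θ * ‖S‖) * θ ^ 2 *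
          (centeredOuter S x *ᵥ u ⬝ᵥ centeredOuter S x *ᵥ u) := by
    simp only [quadExpBound, smul_mulVec, dotProduct_smul, smul_dotProduct, smul_eq_mul]
    ring
  have hcoef0 : 0 ≤ expCoeff (θ * ‖S‖) := by unfold expCoeff; positivity
  obtain ⟨h1i, h1⟩ := integral_dotProduct_centeredOuter_mulVec hS u
  obtain ⟨h2i, h2⟩ := integral_normSq_centeredOuter_mulVec hS u
  have hPi : Integrable (fun x ↦ u ⬝ᵥ u + (-θ) * (u ⬝ᵥ centeredOuter S x *ᵥ u))
      (multivariateGaussian 0 S) := (integrable_const _).add (h1i.const_mul _)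
  simp only [hdecomp]
  refine ⟨hPi.add (h2i.const_mul _), ?_⟩
  rw [integral_add hPi (h2i.const_mul _), integral_add (integrable_const _) (h1i.const_mul _),
    integral_const_mul, integral_const_mul, h1, h2]
  have hvar := mul_le_mul_of_nonneg_left (variance_proxy_le hS u)
    (mul_nonneg hcoef0 (sq_nonneg θ))
  have hc := mul_le_mul_of_nonneg_left
    (two_mul_expCoeff_le hr0 (mul_le_mul_of_nonneg_left hS.norm_le_trace hθ) hτ)
    (mul_nonneg (mul_nonneg (sq_nonneg θ) (mul_nonneg hS.trace_nonneg (norm_nonneg S))) huu)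
  simp only [integral_const, probReal_univ, one_smul, mul_zero, add_zero]
  refine (add_le_add_right hvar _).trans ?_
  calc _ = u ⬝ᵥ u + θ ^ 2 * (S.trace * ‖S‖) * (u ⬝ᵥ u) * (2 * expCoeff (θ * ‖S‖)) := by ring
    _ ≤ _ := add_le_add_right hc _
    _ = _ := by ring

/-- On the negative side `-(x xᵀ - S) ≤ S`, so the exponent is bounded above by a constant. -/
lemma lintegral_trace_exp_neg_smul_centeredOuter_le (hS : S.PosSemidef) {θ : ℝ} (hθ : 0 ≤ θ)
    (hτ : θ * S.trace < 1 / 8) {H : Matrix ι ι ℝ} (hH : H.IsSymm) :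
    ∫⁻ x, ENNReal.ofReal (NormedSpace.exp (H + (-θ) • centeredOuter S x)).trace
        ∂(multivariateGaussian 0 S) ≤
      ENNReal.ofReal ((1 + θ ^ 2 * (S.trace * ‖S‖) / (1 - 8 * (θ * S.trace))) *
        (NormedSpace.exp H).trace) := by
  have hSs : S.IsSymm := isHermitian_iff_isSymm.1 hS.1
  refine lintegral_trace_exp_add_le (r := fun _ ↦ θ * ‖S‖)
    (fun x ↦ (isSymm_centeredOuter hSs x).smul (-θ))
    (fun _ ↦ mul_nonneg hθ (norm_nonneg S)) (fun x ↦ ?_)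
    (fun u ↦ (integral_quadExpBound_neg_smul_centeredOuter_le hS u hθ hτ).1)
    (fun u ↦ (integral_quadExpBound_neg_smul_centeredOuter_le hS u hθ hτ).2) hH
  have h := ((posSemidef_norm_smul_one_sub hSs).add (posSemidef_vecMulVec_self x.ofLp)).smul hθ
  have e : (θ * ‖S‖) • (1 : Matrix ι ι ℝ) - (-θ) • centeredOuter S x =
      θ • (‖S‖ • (1 : Matrix ι ι ℝ) - S + vecMulVec x.ofLp x.ofLp) := by
    rw [centeredOuter, mul_smul, neg_smul, ← smul_neg, ← smul_sub]
    congr 1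
    abel
  rw [e]
  exact h

end ProbabilityTheory

/-! ### Tail bound for the sample covariance matrix -/

namespace ProbabilityTheory

/-- Tail of a sum of independent centred Gaussian outer products, with the Laplace parameter
`θ = δ / (2 tr S (‖S‖ + 4 δ))`. For this choice `1 - 8 θ tr S = ‖S‖ / (‖S‖ + 4 δ)` and the factor per
summand is exactly `1 + θ δ / 2`. -/
lemma measure_lt_norm_sum_centeredOuter_le {ι : Type*} [Fintype ι] [DecidableEq ι]
    {S : Matrix ι ι ℝ} (hS : S.PosSemidef) (hT : 0 < S.trace) (hs : 0 < ‖S‖) {δ : ℝ} (hδ : 0 < δ)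
    (L : ℕ) :
    (Measure.pi fun _ : Fin L ↦ multivariateGaussian 0 S).real
        {x | L * δ < ‖∑ i, centeredOuter S (x i)‖} ≤
      2 * Fintype.card ι * ((1 + δ ^ 2 / (4 * S.trace * (‖S‖ + 4 * δ))) ^ L *
        Real.exp (-(2 * (L * (δ ^ 2 / (4 * S.trace * (‖S‖ + 4 * δ))))))) := by
  have hSs : S.IsSymm := Matrix.isHermitian_iff_isSymm.1 hS.1
  set T := S.trace
  set s := ‖S‖
  set θ := δ / (2 * T * (s + 4 * δ)) with hθdef
  have hθ : 0 < θ := by positivity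
  have hτ : θ * T = δ / (2 * (s + 4 * δ)) := by rw [hθdef]; field_simp
  have hτ8 : θ * T < 1 / 8 := by
    rw [hτ, div_lt_div_iff₀ (by positivity) (by norm_num)]
    linarith
  have h18 : 1 - 8 * (θ * T) = s / (s + 4 * δ) := by
    rw [hτ]; field_simp; ring
  have hC : 1 + θ ^ 2 * (T * s) / (1 - 8 * (θ * T)) = 1 + δ ^ 2 / (4 * T * (s + 4 * δ)) := by
    rw [h18, hθdef]; field_simp; ring
  have h := Matrix.measure_lt_norm_sum_le (μ := multivariateGaussian 0 S) (X := centeredOuter S)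
    (C := 1 + θ ^ 2 * (T * s) / (1 - 8 * (θ * T))) (t := L * δ) continuous_centeredOuter
    (isSymm_centeredOuter hSs) (by rw [hC]; positivity) (by positivity) hθ
    (fun H hH ↦ lintegral_trace_exp_smul_centeredOuter_le hS hθ.le hT hτ8 hH)
    (fun H hH ↦ lintegral_trace_exp_neg_smul_centeredOuter_le hS hθ.le hτ8 hH) L
  have e : θ * (L * δ) = 2 * (L * (δ ^ 2 / (4 * T * (s + 4 * δ)))) := by
    rw [hθdef]; field_simp; ring
  rw [hC, e] at h
  exact h

lemma sampleCovariance_sub {n L : ℕ} (hL : 0 < L) (S : Matrix (Fin n) (Fin n) ℝ)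
    (x : Fin L → EuclideanSpace ℝ (Fin n)) :
    sampleCovariance x - S = (1 / (L : ℝ)) • ∑ i, centeredOuter S (x i) := by
  have hL' : (L : ℝ) ≠ 0 := by positivity
  simp only [sampleCovariance, centeredOuter, Finset.sum_sub_distrib, Finset.sum_const,
    Finset.card_univ, Fintype.card_fin, smul_sub]
  rw [← Nat.cast_smul_eq_nsmul ℝ, smul_smul, one_div_mul_cancel hL', one_smul]

lemma norm_sampleCovariance_sub_le_iff {n L : ℕ} (hL : 0 < L) (S : Matrix (Fin n) (Fin n) ℝ)
    (x : Fin L → EuclideanSpace ℝ (Fin n)) (δ : ℝ) :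
    ‖sampleCovariance x - S‖ ≤ δ ↔ ‖∑ i, centeredOuter S (x i)‖ ≤ L * δ := by
  have hL' : (0 : ℝ) < L := by positivity
  rw [sampleCovariance_sub hL, norm_smul, Real.norm_of_nonneg (by positivity), one_div,
    inv_mul_le_iff₀ hL']

/-- The law of an i.i.d. sample: the probability that its empirical covariance is close to `S` is
computed under the product measure. -/
lemma measure_norm_sampleCovariance_sub_le {n L : ℕ} (hL : 0 < L) (S : Matrix (Fin n) (Fin n) ℝ)
    {Ω : Type*} [MeasurableSpace Ω] {P : Measure Ω} [IsProbabilityMeasure P]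
    {x : Fin L → Ω → EuclideanSpace ℝ (Fin n)} {μ : Measure (EuclideanSpace ℝ (Fin n))}
    [IsProbabilityMeasure μ] (hlaw : ∀ i, HasLaw (x i) μ P) (hindep : iIndepFun x P) (δ : ℝ) :
    P.real {ω | ‖sampleCovariance (fun i ↦ x i ω) - S‖ ≤ δ} =
      1 - (Measure.pi fun _ : Fin L ↦ μ).real {y | L * δ < ‖∑ i, centeredOuter S (y i)‖} := by
  have hae (i : Fin L) : AEMeasurable (x i) P := (hlaw i).aemeasurable
  have hmap : P.map (fun ω i ↦ x i ω) = Measure.pi fun _ ↦ μ := by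
    rw [(iIndepFun_iff_map_fun_eq_pi_map hae).1 hindep]
    simp only [(hlaw _).map_eq]
  have hcont : Continuous fun y : Fin L → EuclideanSpace ℝ (Fin n) ↦
      ‖∑ i, centeredOuter S (y i)‖ := by
    have h := continuous_centeredOuter (S := S)
    fun_prop
  have hA : MeasurableSet {y : Fin L → EuclideanSpace ℝ (Fin n) |
      L * δ < ‖∑ i, centeredOuter S (y i)‖} := (isOpen_lt continuous_const hcont).measurableSet
  rw [← probReal_compl_eq_one_sub₀ hA.nullMeasurableSet, ← hmap,
    map_measureReal_apply_of_aemeasurable (aemeasurable_pi_lambda _ hae) hA.compl]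
  congr 1
  ext ω
  simp [norm_sampleCovariance_sub_le_iff hL]

end ProbabilityTheory

/-- Here `‖·‖` is the spectral norm of a matrix, the operator norm for the Euclidean norm. -/
theorem corollary1 {n L : ℕ} (hn : 0 < n) (hL : 0 < L)
    (S : Matrix (Fin n) (Fin n) ℝ) (hS : S.PosSemidef)
    {Ω : Type*} [MeasurableSpace Ω] (P : Measure Ω) [IsProbabilityMeasure P]
    (x : Fin L → Ω → EuclideanSpace ℝ (Fin n))
    (hlaw : ∀ i, HasLaw (x i) (multivariateGaussian 0 S) P)
    (hindep : iIndepFun x P)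
    (δ₀ : ℝ) (hδ₀ : 0 < δ₀)
    (hsize : 4 * √(n : ℝ) * S.trace * (‖S‖ / δ₀ ^ 2 + 4 / δ₀) ≤ (L : ℝ)) :
    1 - 2 * (n : ℝ) * Real.exp (-√(n : ℝ)) <
      P.real {ω | ‖sampleCovariance (fun i => x i ω) - S‖ ≤ δ₀} := by
  have hn' : (0 : ℝ) < n := by exact_mod_cast hn
  have hL' : (0 : ℝ) < L := by exact_mod_cast hL
  rw [measure_norm_sampleCovariance_sub_le hL S hlaw hindep δ₀]
  refine sub_lt_sub_left ?_ 1
  rcases hS.trace_nonneg.eq_or_lt with hT | hT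
  · -- degenerate case: `S = 0` and the Gaussian is a point mass
    have hS0 : S = 0 := hS.trace_eq_zero_iff.1 hT.symm
    subst hS0
    have hdirac : multivariateGaussian 0 (0 : Matrix (Fin n) (Fin n) ℝ) = Measure.dirac 0 := by
      simp [multivariateGaussian]
    have hzero : (Measure.pi fun _ : Fin L ↦ multivariateGaussian 0
        (0 : Matrix (Fin n) (Fin n) ℝ)).real {y | L * δ₀ < ‖∑ i, centeredOuter 0 (y i)‖} = 0 := by
      have hall : ∀ᵐ y ∂(Measure.pi fun _ : Fin L ↦ multivariateGaussian 0
          (0 : Matrix (Fin n) (Fin n) ℝ)), ∀ i, y i = 0 := by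
        refine ae_all_iff.2 fun i ↦ ?_
        have h : ∀ᵐ z ∂(multivariateGaussian 0 (0 : Matrix (Fin n) (Fin n) ℝ)), z = 0 := by
          rw [hdirac, ae_dirac_eq]
          rfl
        exact (measurePreserving_eval (fun _ : Fin L ↦ multivariateGaussian 0
          (0 : Matrix (Fin n) (Fin n) ℝ)) i).quasiMeasurePreserving.ae h
      rw [measureReal_def, measure_eq_zero_iff_ae_notMem.2, ENNReal.toReal_zero]
      filter_upwards [hall] with y hy
      simp only [hy, centeredOuter, WithLp.ofLp_zero, Matrix.vecMulVec_zero,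
        sub_zero, Finset.sum_const_zero, norm_zero, not_lt]
      positivity
    rw [hzero]
    positivity
  · have hs : 0 < ‖S‖ := norm_pos_iff.2 fun h ↦ by simp [h] at hT
    refine (measure_lt_norm_sum_centeredOuter_le hS hT hs hδ₀ L).trans_lt ?_
    rw [Fintype.card_fin]
    set y := δ₀ ^ 2 / (4 * S.trace * (‖S‖ + 4 * δ₀)) with hy
    have hy0 : 0 < y := by positivity
    have hLy : √(n : ℝ) ≤ L * y := by
      have h := mul_le_mul_of_nonneg_right hsize hy0.le
      refine le_trans (le_of_eq ?_) h
      rw [hy]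
      field_simp
    have hpow : (1 + y) ^ L < Real.exp (L * y) := by
      rw [Real.exp_nat_mul]
      refine pow_lt_pow_left₀ ?_ (by positivity) hL.ne'
      rw [add_comm]
      exact Real.add_one_lt_exp hy0.ne'
    have hfin : (1 + y) ^ L * Real.exp (-(2 * (L * y))) < Real.exp (-√(n : ℝ)) := by
      calc (1 + y) ^ L * Real.exp (-(2 * (L * y)))
          < Real.exp (L * y) * Real.exp (-(2 * (L * y))) := by gcongr
        _ = Real.exp (-(L * y)) := by rw [← Real.exp_add]; congr 1; ring
        _ ≤ Real.exp (-√(n : ℝ)) := Real.exp_le_exp.2 (neg_le_neg hLy)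
    gcongr
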